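/- Setting. Let $\mathbb{S}^d\subset\mathbb{R}^{d+1}$ (coordinates $x_0,\dots,x_d$) be the unit sphere and let $\mathcal{B}=\{x\in\mathbb{S}^d : -x_0^2+x_1^2+\dots+x_d^2\le 0,\ x_0\ge 0\}$, a spherical cap with boundary $\mathcal{S}$. A spherical $d$-polytope is a set $\mathcal{P}=\mathcal{K}\cap\mathbb{S}^d$, where $\mathcal{K}\subset\mathbb{R}^{d+1}$ is a full-dimensional conical hull of finitely many vectors that contains no line through $0$. Its faces are the intersections $\mathcal{P}\cap H$ with linear hyperplanes $H$ having $\mathcal{P}$ in one of their closed sides $H^-$, together with $\mathcal{P}$ itself; ordered by inclusion, they form its face lattice. A proper face $F$ of $\mathcal{P}$ strongly cuts $\mathcal{S}$ if $\operatorname{relint}(F)\cap\mathcal{B}\neq\emptyset$; it strongly avoids $\mathcal{S}$ if there is a linear hyperplane $H$ with $\mathcal{P}\cup\mathcal{B}\subset H^-$ and $F=H\cap\mathcal{P}$. For $0\le i\le j\le d-1$, a combinatorial type of $d$-polytopes is $(i,j)$-scribable if it is realized by (i.e. its face lattice is isomorphic to that of) a spherical $d$-polytope all of whose $i$-faces strongly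 avoid $\mathcal{S}$ and all of whose $j$-faces strongly cut $\mathcal{S}$. For $n\ge d+1$, the cyclic polytope $C_d(n)$ is the combinatorial type of the convex hull of $n$ points with distinct parameters on a curve of order $d$ in $\mathbb{R}^d$, that is, a continuous curve, parametrized by an interval, that every affine hyperplane meets for at most $d$ parameters (for instance the moment curve $(t,t^2,\dots,t^d)$). Proposition. Let $d\ge 3$ be odd and let $n\ge d+1$. Then the cyclic polytope $C_d(n)$ is $(1,d-1)$-scribable. -/

import Mathlib

namespace Scribability

/-- Euclidean space `ℝ^m`. -/
abbrev E (m : ℕ) : Type := EuclideanSpace ℝ (Fin m)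

/-! ### Spherical polytopes and their faces -/

/-- A spherical polytope in the unit sphere `𝕊^d ⊂ ℝ^(d+1)`: the intersection with `𝕊^d` of a
pointed polyhedral cone, i.e. of the conical hull of finitely many vectors that does not contain
two opposite non-zero vectors. -/
def IsSphericalPolytope (d : ℕ) (P : Set (E (d + 1))) : Prop :=
  ∃ V : Set (E (d + 1)), V.Finite ∧
    (∀ x ∈ PointedCone.hull ℝ V, x ≠ 0 → -x ∉ PointedCone.hull ℝ V) ∧
    P = {x | x ∈ PointedCone.hull ℝ V ∧ ‖x‖ = 1}

/-- A spherical `d`-polytope in `𝕊^d` (full-dimensional). -/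
def IsSphericalDPolytope (d : ℕ) (P : Set (E (d + 1))) : Prop :=
  IsSphericalPolytope d P ∧ Submodule.span ℝ P = ⊤

/-- `F` is cut out of `P` by the hyperplane `{x | ⟪a, x⟫ = 0}`, where `P` lies in the closed
half-space `{x | ⟪a, x⟫ ≤ 0}`. -/
def CutsOut {m : ℕ} (a : E m) (P F : Set (E m)) : Prop :=
  (∀ x ∈ P, inner ℝ a x ≤ 0) ∧ F = {x ∈ P | inner ℝ a x = 0}

/-- The faces of a spherical polytope; the improper faces `∅` and `P` (`a = 0`) are included. -/
def IsSphericalFace {m : ℕ} (P F : Set (E m)) : Prop :=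
  ∃ a : E m, CutsOut a P F

/-- The face lattice of a spherical polytope, ordered by inclusion. -/
abbrev SphericalFaces {m : ℕ} (P : Set (E m)) : Type :=
  {F : Set (E m) // IsSphericalFace P F}

/-- The face lattice of a convex polytope in Euclidean space, ordered by inclusion: the sets of
maximisers of linear functionals (among them the whole polytope), and the empty face. -/
abbrev EuclideanFaces {m : ℕ} (P : Set (E m)) : Type :=
  {F : Set (E m) // IsExposed ℝ P F}

/-- `F` is a `k`-dimensional face of the spherical polytope `P`. -/
def IsKFace {m : ℕ} (k : ℕ) (P F : Set (E m)) : Prop :=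
  IsSphericalFace P F ∧ Module.finrank ℝ (Submodule.span ℝ F) = k + 1

/-- The relative interior of a spherical polytope `F`, i.e. its interior in its spherical span
(the unit sphere of the linear span of `F`). -/
def sphericalRelint {m : ℕ} (F : Set (E m)) : Set (E m) :=
  {x ∈ F | ∃ ε > 0, ∀ y ∈ Submodule.span ℝ F, ‖y‖ = 1 → dist y x < ε → y ∈ F}

/-! ### The light cone and scribability -/

/-- The Lorentzian scalar product `-x₀y₀ + x₁y₁ + ⋯ + x_d y_d` on `ℝ^(d+1)`. -/
def lorentz {d : ℕ} (x y : E (d + 1)) : ℝ :=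
  -(x 0 * y 0) + ∑ i : Fin d, x i.succ * y i.succ

/-- The ball `𝓑`: the spherical cap of `𝕊^d` cut out by the light cone. -/
def cap (d : ℕ) : Set (E (d + 1)) :=
  {x | lorentz x x ≤ 0 ∧ 0 ≤ x 0 ∧ ‖x‖ = 1}

/-- `F` strongly cuts the sphere `∂𝓑`: its relative interior meets the ball `𝓑`. -/
def StronglyCuts {d : ℕ} (F : Set (E (d + 1))) : Prop :=
  (sphericalRelint F ∩ cap d).Nonempty

/-- The face `F` of `P` strongly avoids the sphere `∂𝓑`: some hyperplane supporting `P`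
meets `P` exactly in `F`, and `𝓑` lies on the same closed side of it as `P`. -/
def StronglyAvoids {d : ℕ} (P F : Set (E (d + 1))) : Prop :=
  ∃ a : E (d + 1), a ≠ 0 ∧ CutsOut a P F ∧ ∀ x ∈ cap d, inner ℝ a x ≤ 0

/-- `P` is (strongly) `(i,j)`-scribed: every `i`-face strongly avoids the sphere and every
`j`-face strongly cuts it. -/
def IsScribed {d : ℕ} (i j : ℕ) (P : Set (E (d + 1))) : Prop :=
  (∀ F, IsKFace i P F → StronglyAvoids P F) ∧ (∀ F, IsKFace j P F → StronglyCuts F)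

/-- The combinatorial type of `d`-polytopes with face lattice `L` is (strongly)
`(i,j)`-scribable: some `(i,j)`-scribed spherical `d`-polytope has a face lattice isomorphic
to `L`. (To be used for `0 ≤ i ≤ j ≤ d - 1`.) -/
def IsScribable (d i j : ℕ) (L : Type*) [PartialOrder L] : Prop :=
  ∃ P : Set (E (d + 1)), IsSphericalDPolytope d P ∧ IsScribed i j P ∧
    Nonempty (SphericalFaces P ≃o L)

/-! ### Cyclic polytopes -/

/-- `γ` restricted to the interval `I` is a curve of order `d` in `ℝ^d`: it is continuous and every
affine hyperplane meets it for at most `d` values of the parameter. -/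
def IsCurveOfOrder (d : ℕ) (I : Set ℝ) (γ : ℝ → E d) : Prop :=
  I.OrdConnected ∧ ContinuousOn γ I ∧
    ∀ (a : E d) (b : ℝ), a ≠ 0 → {s ∈ I | inner ℝ a (γ s) = b}.encard ≤ d

/-- `L` is the combinatorial type (face lattice) of a cyclic `d`-polytope with `n` vertices: it is
isomorphic to the face lattice of the convex hull of `n ≥ d + 1` points with distinct parameters
on a curve of order `d` in `ℝ^d`. -/
def IsCyclicType (d n : ℕ) (L : Type*) [PartialOrder L] : Prop :=
  d < n ∧ ∃ (I : Set ℝ) (γ : ℝ → E d) (t : Fin n → ℝ),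
    IsCurveOfOrder d I γ ∧ StrictMono t ∧ (∀ k, t k ∈ I) ∧
    Nonempty (L ≃o EuclideanFaces (convexHull ℝ (Set.range fun k => γ (t k))))

end Scribability

namespace Scribability

open Module

/-! Write d = D + 2 with D odd. By Gale's evenness condition, every facet of an odd-dimensional
cyclic polytope contains the first or the last vertex. Hence the face lattice is already determined
by the signs of those maximal minors that involve an end (`EndPositive.isFaceSet_iff`), and the
other minors may vanish. This leaves room for a degenerate realization: all inner vertices ("sites")
lie in the hyperplane x₂ = 0, and the two end vertices ("apices") lie on opposite sides of it.

Let p = (1, 1, 0, …, 0), a null vector. The apices are p ± h e₂. The vectors of the light cone in x₂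
= 0 with Lorentzian product -1 with p form a paraboloid, and the sites are points of the moment
curve of ℝ^D placed at depth c below it. `endPositive_vertex` shows that this configuration has the
cyclic type.

Facets: one without an apex would span x₂ = 0, which contains the midpoint p of the apices; a
supporting functional vanishing at p vanishes at both apices, a contradiction. When 2ch² = 1, every
edge or segment from an apex to another vertex is tangent to the light cone. A facet therefore
contains an apex and causal vectors, which add up to a causal vector in its relative interior.

Edges: the point of tangency on an edge at an apex is also the Lorentzian normal of a supporting
hyperplane, since distinct sites have positive distance. An edge between two sites is a Delaunay
edge, described by a paraboloid inequality that does not involve c; its Lorentzian normal becomes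
causal once c is large. There are finitely many edges, so one c serves for all, and h is then fixed
by 2ch² = 1 (`exists_isFuture_edge`, `isScribed_vertex`). -/

/-- `S` is the zero set of a linear functional that is non-negative on the configuration `v`. -/
def IsFaceSet {ι V : Type*} [AddCommGroup V] [Module ℝ V] (v : ι → V) (S : Set ι) : Prop :=
  ∃ f : Dual ℝ V, (∀ k, 0 ≤ f (v k)) ∧ ∀ k, k ∈ S ↔ f (v k) = 0

/-! ### Enlarging faces of polyhedral cones to facets. -/

section FaceSets

variable {ι V : Type*} [AddCommGroup V] [Module ℝ V]

/-- Ratio test: `e` is tilted along `b` until the first generator with `b` negative reaches zero.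
The assumption `hb` ensures that the zero obtained is a new one. -/
lemma exists_add_smul_nonneg [Fintype ι] {v : ι → V} {e b : Dual ℝ V}
    (he : ∀ k, 0 ≤ e (v k)) {k : ι} (hk : b (v k) < 0)
    (hb : ∀ k, e (v k) = 0 → b (v k) = 0) :
    ∃ t : ℝ, (∀ i, 0 ≤ (e + t • b) (v i)) ∧ ∃ i, e (v i) ≠ 0 ∧ (e + t • b) (v i) = 0 := by
  classical
  obtain ⟨i, hi, hmin⟩ := Finset.exists_min_image
    (Finset.univ.filter fun k => b (v k) < 0) (fun k => e (v k) / (-b (v k)))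
    ⟨k, by simpa using hk⟩
  simp only [Finset.mem_filter, Finset.mem_univ, true_and] at hi hmin
  have hi' : 0 < -b (v i) := by linarith
  refine ⟨e (v i) / (-b (v i)), fun l => ?_, i, fun h => hi.ne (hb i h), ?_⟩
  · simp only [LinearMap.add_apply, LinearMap.smul_apply, smul_eq_mul]
    rcases lt_or_ge (b (v l)) 0 with hl | hl
    · have h1 := hmin l hl
      rw [le_div_iff₀ (by linarith)] at h1
      linarith
    · have := mul_nonneg (div_nonneg (he i) hi'.le) hl
      linarith [he l]
  · simp only [LinearMap.add_apply, LinearMap.smul_apply, smul_eq_mul]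
    have : b (v i) ≠ 0 := hi.ne
    field_simp
    ring

lemma exists_dual_ne_zero_of_card_lt [FiniteDimensional ℝ V] (v : ι → V) (Z : Finset ι) (j : ι)
    (h : Z.card + 1 < finrank ℝ V) :
    ∃ b : Dual ℝ V, b ≠ 0 ∧ (∀ k ∈ Z, b (v k) = 0) ∧ b (v j) = 0 := by
  classical
  have hlt : Submodule.span ℝ (((insert j Z).image v : Finset V) : Set V) < ⊤ := by
    refine lt_top_iff_ne_top.2 fun htop => ?_
    have h1 := finrank_span_finset_le_card (R := ℝ) ((insert j Z).image v)
    rw [Set.finrank, htop, finrank_top] at h1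
    have h2 := (Finset.card_image_le (s := insert j Z) (f := v)).trans (Finset.card_insert_le j Z)
    omega
  obtain ⟨b, hb, hle⟩ := Submodule.exists_le_ker_of_lt_top _ hlt
  have key : ∀ k ∈ insert j Z, b (v k) = 0 := fun k hk =>
    hle (Submodule.subset_span (Finset.mem_coe.2 (Finset.mem_image_of_mem v hk)))
  exact ⟨b, hb, fun k hk => key k (Finset.mem_insert_of_mem hk),
    key j (Finset.mem_insert_self j Z)⟩

/-- Every face of a full-dimensional cone that misses a generator extends to one which misses that
generator and contains at least `dim - 1` generators. -/
lemma exists_dual_card_zeros_ge [Fintype ι] [FiniteDimensional ℝ V] {d : ℕ}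
    (hd : finrank ℝ V = d + 1) {v : ι → V} (hv : Submodule.span ℝ (Set.range v) = ⊤)
    {f : Dual ℝ V} (hf : ∀ k, 0 ≤ f (v k)) {j : ι} (hj : 0 < f (v j)) :
    ∃ e : Dual ℝ V, (∀ k, 0 ≤ e (v k)) ∧ (∀ k, f (v k) = 0 → e (v k) = 0) ∧ 0 < e (v j) ∧
      ∃ K : Finset ι, K.card = d ∧ ∀ k ∈ K, e (v k) = 0 := by
  classical
  induction hm : (Finset.univ.filter fun k => f (v k) ≠ 0).card using Nat.strong_induction_on
    generalizing f with
  | _ m ih =>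
  by_cases hc : d ≤ (Finset.univ.filter fun k => f (v k) = 0).card
  · obtain ⟨K, hK, hcard⟩ := Finset.exists_subset_card_eq hc
    exact ⟨f, hf, fun _ h => h, hj, K, hcard, fun k hk => by simpa using hK hk⟩
  -- As `b` also vanishes at `v j`, tilting keeps the value there, so `j` stays off the face while
  -- the zero set grows.
  · obtain ⟨b, hb0, hbZ, hbj⟩ := exists_dual_ne_zero_of_card_lt v
      (Finset.univ.filter fun k => f (v k) = 0) j (by omega)
    have hbZ' : ∀ k, f (v k) = 0 → b (v k) = 0 := fun k hk => hbZ k (by simpa using hk)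
    obtain ⟨k, hk⟩ : ∃ k, b (v k) ≠ 0 := by
      by_contra! hall
      refine hb0 (LinearMap.ext fun x => ?_)
      have hx : x ∈ Submodule.span ℝ (Set.range v) := hv ▸ Submodule.mem_top
      have hle : Submodule.span ℝ (Set.range v) ≤ LinearMap.ker b :=
        Submodule.span_le.2 (by rintro _ ⟨k, rfl⟩; exact hall k)
      exact hle hx
    obtain ⟨b', hbZ'', hbj', hk'⟩ : ∃ b' : Dual ℝ V, (∀ k, f (v k) = 0 → b' (v k) = 0) ∧
        b' (v j) = 0 ∧ b' (v k) < 0 := by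
      rcases lt_or_gt_of_ne hk with h | h
      · exact ⟨b, hbZ', hbj, h⟩
      · exact ⟨-b, fun k hk => by simp [hbZ' k hk], by simp [hbj], by simpa using h⟩
    obtain ⟨t, hnn, i, hi, hi0⟩ := exists_add_smul_nonneg hf hk' hbZ''
    have hz : ∀ k, f (v k) = 0 → (f + t • b') (v k) = 0 := fun k hk => by simp [hk, hbZ'' k hk]
    obtain ⟨e, h1, h2, h3⟩ := ih _ (by
      rw [← hm]
      refine Finset.card_lt_card (Finset.ssubset_iff_of_subset ?_ |>.2 ⟨i, by simpa using hi, ?_⟩)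
      · intro k hk
        simp only [Finset.mem_filter, Finset.mem_univ, true_and] at hk ⊢
        exact fun h => hk (hz k h)
      · simpa using hi0) hnn (by simpa [hbj'] using hj) rfl
    exact ⟨e, h1, fun k hk => h2 k (hz k hk), h3⟩

end FaceSets

/-! ### Gale's evenness condition from the signs of end minors. -/

section Gale

/-- The number of elements of `K` below `j`. -/
def rankBelow {n : ℕ} (K : Finset (Fin n)) (j : Fin n) : ℕ := (K.filter (· < j)).card

/-- Gale's condition on the vertex set of a facet of an odd-dimensional cyclic polytope: it has
`d` elements, one of them the first or the last vertex, and all other vertices are on the same side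
of the hyperplane that it spans. -/
def IsGale {M : ℕ} (d : ℕ) (K : Finset (Fin (M + 1))) : Prop :=
  K.card = d ∧ (0 ∈ K ∨ Fin.last M ∈ K) ∧
    ∀ i ∉ K, ∀ j ∉ K, (-1 : ℝ) ^ rankBelow K i = (-1) ^ rankBelow K j

lemma exists_strictMono_insertNth {n d : ℕ} {K : Finset (Fin n)} (hK : K.card = d) {j : Fin n}
    (hj : j ∉ K) : ∃ p : Fin (d + 1), (p : ℕ) = rankBelow K j ∧
      StrictMono (p.insertNth j (K.orderEmbOfFin hK) : Fin (d + 1) → Fin n) := by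
  have hc : (insert j K).card = d + 1 := by rw [Finset.card_insert_of_notMem hj, hK]
  set κ := (insert j K).orderEmbOfFin hc with hκ
  have hrange : Set.range κ = ↑(insert j K) := Finset.range_orderEmbOfFin _ hc
  obtain ⟨p, hp⟩ : j ∈ Set.range κ := by rw [hrange]; simp
  have hemb : κ ∘ p.succAbove = K.orderEmbOfFin hK := by
    refine Finset.orderEmbOfFin_unique hK (fun x => ?_)
      (κ.strictMono.comp (Fin.strictMono_succAbove p))
    have h1 : κ (p.succAbove x) ∈ insert j K := Finset.orderEmbOfFin_mem _ hc _
    rcases Finset.mem_insert.1 h1 with h | h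
    · rw [← hp] at h
      exact absurd (κ.injective h) (Fin.succAbove_ne p x)
    · exact h
  refine ⟨p, ?_, ?_⟩
  · have : K.filter (· < j) = (Finset.Iio p).map κ.toEmbedding := by
      ext a
      simp only [Finset.mem_filter, Finset.mem_map, Finset.mem_Iio, RelEmbedding.coe_toEmbedding]
      constructor
      · rintro ⟨haK, haj⟩
        obtain ⟨q, rfl⟩ : a ∈ Set.range κ := by rw [hrange]; simp [haK]
        exact ⟨q, by rwa [← hp, κ.lt_iff_lt] at haj, rfl⟩
      · rintro ⟨q, hq, rfl⟩
        have h1 : κ q ∈ insert j K := Finset.orderEmbOfFin_mem _ hc _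
        have h2 : κ q < j := by rw [← hp]; exact κ.strictMono hq
        exact ⟨(Finset.mem_insert.1 h1).resolve_left h2.ne, h2⟩
    rw [rankBelow, this, Finset.card_map, Fin.card_Iio]
  · have : (p.insertNth j (K.orderEmbOfFin hK) : Fin (d + 1) → Fin n) = κ := by
      rw [← hemb, Fin.insertNth_eq_iff]
      exact ⟨hp.symm, rfl⟩
    rw [this]
    exact κ.strictMono

variable {V : Type*} [AddCommGroup V] [Module ℝ V] {d M : ℕ}

/-- The functional `x ↦ D(x, w₁, …, w_d)`. -/
def consFunctional (D : V [⋀^Fin (d + 1)]→ₗ[ℝ] ℝ) (w : Fin d → V) : Dual ℝ V where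
  toFun x := D (Matrix.vecCons x w)
  map_add' x y := by
    exact congrArg (fun g => g w) (D.curryLeft.map_add x y)
  map_smul' c x := by
    exact congrArg (fun g => g w) (D.curryLeft.map_smul c x)

lemma consFunctional_apply (D : V [⋀^Fin (d + 1)]→ₗ[ℝ] ℝ) (w : Fin d → V) (x : V) :
    consFunctional D w x = D (Matrix.vecCons x w) := rfl

lemma consFunctional_self (D : V [⋀^Fin (d + 1)]→ₗ[ℝ] ℝ) (w : Fin d → V) (i : Fin d) :
    consFunctional D w (w i) = 0 :=
  D.map_eq_zero_of_eq _ (i := 0) (j := i.succ) (by simp) (Fin.succ_ne_zero i).symm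

/-- All the maximal minors of `v` that involve the first or the last vector are positive. -/
def EndPositive (D : V [⋀^Fin (d + 1)]→ₗ[ℝ] ℝ) (v : Fin (M + 1) → V) : Prop :=
  ∀ κ : Fin (d + 1) → Fin (M + 1), StrictMono κ → (κ 0 = 0 ∨ κ (Fin.last d) = Fin.last M) →
    0 < D (v ∘ κ)

variable {D : V [⋀^Fin (d + 1)]→ₗ[ℝ] ℝ} {v : Fin (M + 1) → V}

/-- Moving `v j` from its sorted position to the front takes `rankBelow K j` transpositions; the
sorted minor is positive because it involves an end. -/
lemma EndPositive.sign (hD : EndPositive D v) {K : Finset (Fin (M + 1))} (hK : K.card = d)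
    {j : Fin (M + 1)} (hj : j ∉ K) (h : (0 ∈ K ∨ Fin.last M ∈ K) ∨ j = 0 ∨ j = Fin.last M) :
    0 < (-1 : ℝ) ^ rankBelow K j * consFunctional D (v ∘ K.orderEmbOfFin hK) (v j) := by
  obtain ⟨p, hp, hmono⟩ := exists_strictMono_insertNth hK hj
  set κ : Fin (d + 1) → Fin (M + 1) := p.insertNth j (K.orderEmbOfFin hK) with hκ
  have hmem : ∀ a, a = j ∨ a ∈ K → ∃ q, κ q = a := by
    rintro a (rfl | ha)
    · exact ⟨p, by simp [hκ]⟩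
    · obtain ⟨q, hq⟩ : a ∈ Set.range (K.orderEmbOfFin hK) := by
        rw [Finset.range_orderEmbOfFin]; exact ha
      exact ⟨p.succAbove q, by simp [hκ, hq]⟩
  have hend : κ 0 = 0 ∨ κ (Fin.last d) = Fin.last M := by
    have h0 : (0 = j ∨ 0 ∈ K) → κ 0 = 0 := fun h => by
      obtain ⟨q, hq⟩ := hmem 0 h
      exact le_antisymm ((hmono.monotone (Fin.zero_le q)).trans hq.le) (Fin.zero_le _)
    have h1 : (Fin.last M = j ∨ Fin.last M ∈ K) → κ (Fin.last d) = Fin.last M := fun h => by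
      obtain ⟨q, hq⟩ := hmem _ h
      exact le_antisymm (Fin.le_last _) (hq.ge.trans (hmono.monotone (Fin.le_last q)))
    rcases h with (h | h) | h | h
    · exact Or.inl (h0 (Or.inr h))
    · exact Or.inr (h1 (Or.inr h))
    · exact Or.inl (h0 (Or.inl h.symm))
    · exact Or.inr (h1 (Or.inl h.symm))
  have hpos := hD κ hmono hend
  have hcomp : v ∘ κ = p.insertNth (v j) (v ∘ K.orderEmbOfFin hK) := by
    rw [Fin.eq_insertNth_iff]
    refine ⟨by simp [hκ], ?_⟩
    funext q
    simp [hκ, Fin.removeNth]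
  rw [hcomp, AlternatingMap.map_insertNth, hp] at hpos
  simpa [consFunctional_apply] using hpos

lemma EndPositive.span_eq_top (hD : EndPositive D v) (hM : d ≤ M) [FiniteDimensional ℝ V]
    (hV : finrank ℝ V = d + 1) : Submodule.span ℝ (Set.range v) = ⊤ := by
  have hlin : LinearIndependent ℝ (v ∘ Fin.castLE (by omega : d + 1 ≤ M + 1)) := by
    by_contra h
    have := hD _ (Fin.strictMono_castLE (by omega)) (Or.inl rfl)
    rw [D.map_linearDependent _ h] at this
    exact this.false
  have := hlin.span_eq_top_of_card_eq_finrank' (by simp [hV])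
  exact top_le_iff.1 (this.ge.trans (Submodule.span_mono (Set.range_comp_subset_range _ _)))

/-- Since `x` and `w` form a basis, a functional that vanishes on `w` is determined by its value at
`x`. -/
lemma eq_smul_consFunctional [FiniteDimensional ℝ V] (hV : finrank ℝ V = d + 1) {w : Fin d → V}
    {x : V} (hx : consFunctional D w x ≠ 0) {e : Dual ℝ V} (he : ∀ i, e (w i) = 0) :
    e = (e x / consFunctional D w x) • consFunctional D w := by
  have hlin : LinearIndependent ℝ (Matrix.vecCons x w) := by
    by_contra h
    exact hx (D.map_linearDependent _ h)
  have hspan := hlin.span_eq_top_of_card_eq_finrank' (by simp [hV])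
  refine LinearMap.ext_on_range hspan fun i => ?_
  refine Fin.cases ?_ (fun i => ?_) i
  · simp [hx]
  · simp [he, consFunctional_self]

lemma rankBelow_zero (K : Finset (Fin (M + 1))) : rankBelow K 0 = 0 := by
  simp [rankBelow]

lemma rankBelow_last {K : Finset (Fin (M + 1))} (h : Fin.last M ∉ K) :
    rankBelow K (Fin.last M) = K.card := by
  rw [rankBelow, Finset.filter_true_of_mem]
  intro x hx
  exact lt_of_le_of_ne (Fin.le_last x) (by rintro rfl; exact h hx)

/-- The face sets of an end-positive configuration in odd dimension are determined by Gale's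
condition. -/
theorem EndPositive.isFaceSet_iff (hD : EndPositive D v) (hd : Odd d) (hM : d ≤ M)
    [FiniteDimensional ℝ V] (hV : finrank ℝ V = d + 1) (S : Set (Fin (M + 1))) :
    IsFaceSet v S ↔ ∀ j ∉ S, ∃ K, IsGale d K ∧ S ⊆ K ∧ j ∉ K := by
  classical
  constructor
  · rintro ⟨f, hf, hS⟩ j hj
    have hj' : 0 < f (v j) := lt_of_le_of_ne (hf j) fun h => hj ((hS j).2 h.symm)
    obtain ⟨e, he, hfe, hej, K, hK, hKe⟩ :=
      exists_dual_card_zeros_ge hV (hD.span_eq_top hM hV) hf hj'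
    set F := consFunctional D (v ∘ K.orderEmbOfFin hK) with hF
    have heK : ∀ i, e ((v ∘ K.orderEmbOfFin hK) i) = 0 := fun i =>
      hKe _ (Finset.orderEmbOfFin_mem K hK i)
    have hjK : j ∉ K := fun h => hej.ne' (hKe j h)
    by_cases hend : 0 ∈ K ∨ Fin.last M ∈ K
    · have hsign := fun i (hi : i ∉ K) => hD.sign hK hi (Or.inl hend)
      have hne : ∀ i, i ∉ K → F (v i) ≠ 0 := fun i hi h => by
        have := hsign i hi
        rw [← hF, h, mul_zero] at this
        exact this.false
      have heq := eq_smul_consFunctional hV (hne j hjK) heK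
      set c := e (v j) / F (v j)
      have hc : c ≠ 0 := div_ne_zero hej.ne' (hne j hjK)
      have hepos : ∀ i, i ∉ K → 0 < c * F (v i) := fun i hi => by
        have h1 : e (v i) = c * F (v i) := by rw [heq]; rfl
        exact lt_of_le_of_ne (h1 ▸ he i) (mul_ne_zero hc (hne i hi)).symm
      refine ⟨K, ⟨hK, hend, fun i hi l hl => ?_⟩, fun i hi => ?_, hjK⟩
      · have h1 := hsign i hi
        have h2 := hsign l hl
        have h3 := hepos i hi
        have h4 := hepos l hl
        rw [← hF] at h1 h2
        rcases neg_one_pow_eq_or ℝ (rankBelow K i) with h | h <;>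
        rcases neg_one_pow_eq_or ℝ (rankBelow K l) with h' | h' <;>
        rw [h] at h1 ⊢ <;> rw [h'] at h2 ⊢ <;> exfalso <;>
        rcases lt_or_gt_of_ne hc with h5 | h5 <;> nlinarith
      · by_contra hiK
        have h1 : e (v i) = c * F (v i) := by rw [heq]; rfl
        have h2 := hepos i hiK
        rw [← h1, hfe i ((hS i).1 hi)] at h2
        exact h2.false
    -- A set `K` without both ends cannot support a face: as `d` is odd, `F` is positive at the
    -- first vertex and negative at the last, so the non-negative multiple `e` of `F` would be zero.
    · exfalso
      push Not at hend
      have h0 := hD.sign hK hend.1 (Or.inr (Or.inl rfl))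
      have h1 := hD.sign hK hend.2 (Or.inr (Or.inr rfl))
      rw [rankBelow_zero, pow_zero, one_mul, ← hF] at h0
      rw [rankBelow_last hend.2, hK, hd.neg_one_pow, ← hF] at h1
      have heq := eq_smul_consFunctional hV h0.ne' heK
      have h2 : e (v (Fin.last M)) = e (v 0) / F (v 0) * F (v (Fin.last M)) := by
        nth_rewrite 1 [heq]; rfl
      have h3 : e (v j) = e (v 0) / F (v 0) * F (v j) := by
        nth_rewrite 1 [heq]; rfl
      have h4 : 0 ≤ e (v 0) / F (v 0) := div_nonneg (he 0) h0.le
      have h5 : e (v 0) / F (v 0) = 0 := by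
        have := he (Fin.last M)
        rw [h2] at this
        nlinarith
      rw [h3, h5, zero_mul] at hej
      exact hej.false
  · intro h
    have hfun : ∀ j, j ∉ S → ∃ f : Dual ℝ V, (∀ k, 0 ≤ f (v k)) ∧ (∀ k ∈ S, f (v k) = 0) ∧
        0 < f (v j) := by
      intro j hj
      obtain ⟨K, ⟨hK, hend, hpar⟩, hSK, hjK⟩ := h j hj
      have hsign := fun i (hi : i ∉ K) => hD.sign hK hi (Or.inl hend)
      have hzero : ∀ i ∈ K, consFunctional D (v ∘ K.orderEmbOfFin hK) (v i) = 0 := by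
        intro i hi
        obtain ⟨q, rfl⟩ : i ∈ Set.range (K.orderEmbOfFin hK) := by
          rw [Finset.range_orderEmbOfFin]; exact hi
        exact consFunctional_self D (v ∘ K.orderEmbOfFin hK) q
      refine ⟨(-1 : ℝ) ^ rankBelow K j • consFunctional D (v ∘ K.orderEmbOfFin hK),
        fun k => ?_, fun k hk => ?_, hsign j hjK⟩
      · by_cases hk : k ∈ K
        · simp [hzero k hk]
        · rw [LinearMap.smul_apply, smul_eq_mul, hpar j hjK k hk]
          exact (hsign k hk).le
      · simp [hzero k (hSK hk)]
    choose! g hg0 hgS hgj using hfun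
    -- Each summand vanishes on `S`, and each `j ∉ S` is made positive by its own summand.
    refine ⟨∑ j ∈ Finset.univ.filter (· ∉ S), g j, fun k => ?_, fun k => ?_⟩
    · rw [LinearMap.sum_apply]
      exact Finset.sum_nonneg fun j hj => hg0 j (by simpa using hj) k
    · rw [LinearMap.sum_apply]
      constructor
      · intro hk
        exact Finset.sum_eq_zero fun j hj => hgS j (by simpa using hj) k hk
      · intro hsum
        by_contra hk
        rw [Finset.sum_eq_zero_iff_of_nonneg
          (fun j hj => hg0 j (by simpa using hj) k)] at hsum
        exact (hgj k hk).ne' (hsum k (by simpa using hk))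

end Gale

/-! ### Faces of Euclidean polytopes as face sets of homogenized points. -/

/-- The face sets of a configuration, ordered by inclusion. -/
abbrev FaceSets {ι V : Type*} [AddCommGroup V] [Module ℝ V] (v : ι → V) : Type _ :=
  {S : Set ι // IsFaceSet v S}

section EuclideanFaces

variable {ι : Type*} {m : ℕ}

/-- If `l` is maximal on `F` with value m, the functional is (s, x) ↦ s m - l x. Non-emptiness is
needed because `∅` counts as exposed without any functional. -/
lemma isExposed_convexHull_exists {p : ι → E m} {F : Set (E m)} (hne : F.Nonempty)
    (hF : IsExposed ℝ (convexHull ℝ (Set.range p)) F) :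
    ∃ f : Dual ℝ (ℝ × E m), (∀ k, 0 ≤ f (1, p k)) ∧
      F = {x ∈ convexHull ℝ (Set.range p) | f (1, x) = 0} := by
  obtain ⟨l, hl⟩ := hF hne
  obtain ⟨x₀, hx₀⟩ := hne
  rw [hl] at hx₀
  refine ⟨(LinearMap.toSpanSingleton ℝ ℝ (l x₀)).coprod (-(l : E m →ₗ[ℝ] ℝ)), fun k => ?_, ?_⟩
  · have := hx₀.2 (p k) (subset_convexHull ℝ _ ⟨k, rfl⟩)
    simpa using this
  · rw [hl]
    ext x
    constructor
    · rintro ⟨hx, h⟩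
      have h1 := h x₀ hx₀.1
      have h2 := hx₀.2 x hx
      exact ⟨hx, by simp; linarith⟩
    · rintro ⟨hx, h⟩
      refine ⟨hx, fun y hy => ?_⟩
      simp at h
      linarith [hx₀.2 y hy]

lemma isFaceSet_empty_homogenize (p : ι → E m) :
    IsFaceSet (fun k => ((1 : ℝ), p k)) ∅ :=
  ⟨LinearMap.fst ℝ ℝ (E m), fun k => by simp, fun k => by simp⟩

lemma isFaceSet_of_isExposed {p : ι → E m} {F : Set (E m)}
    (hF : IsExposed ℝ (convexHull ℝ (Set.range p)) F) :
    IsFaceSet (fun k => ((1 : ℝ), p k)) {k | p k ∈ F} := by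
  rcases F.eq_empty_or_nonempty with rfl | hne
  · simpa using isFaceSet_empty_homogenize p
  · obtain ⟨f, hf, rfl⟩ := isExposed_convexHull_exists hne hF
    exact ⟨f, hf, fun k => ⟨fun h => h.2, fun h => ⟨subset_convexHull ℝ _ ⟨k, rfl⟩, h⟩⟩⟩

variable [Fintype ι]

lemma mem_convexHull_range_iff {p : ι → E m} {x : E m} :
    x ∈ convexHull ℝ (Set.range p) ↔
      ∃ c : ι → ℝ, (∀ i, 0 ≤ c i) ∧ ∑ i, c i = 1 ∧ ∑ i, c i • p i = x := by
  rw [convexHull_range_eq_exists_affineCombination]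
  constructor
  · rintro ⟨s, w, h0, h1, rfl⟩
    classical
    rw [s.affineCombination_eq_linear_combination p w h1]
    refine ⟨fun i => if i ∈ s then w i else 0, fun i => ?_, ?_, ?_⟩
    · by_cases h : i ∈ s <;> simp [h, h0]
    · simpa using h1
    · simp [ite_smul]
  · rintro ⟨c, h0, h1, rfl⟩
    exact ⟨Finset.univ, c, fun i _ => h0 i, h1,
      Finset.univ.affineCombination_eq_linear_combination p c h1⟩

lemma sum_apply_homogenize {p : ι → E m} {c : ι → ℝ} (hc : ∑ i, c i = 1)
    (f : Dual ℝ (ℝ × E m)) : f (1, ∑ i, c i • p i) = ∑ i, c i * f (1, p i) := by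
  have : ((1 : ℝ), ∑ i, c i • p i) = ∑ i, c i • ((1 : ℝ), p i) := by
    ext1
    · simp [Prod.fst_sum, hc]
    · simp [Prod.snd_sum]
  rw [this, map_sum]
  simp only [map_smul, smul_eq_mul]

lemma homogenize_nonneg {p : ι → E m} {f : Dual ℝ (ℝ × E m)} (hf : ∀ k, 0 ≤ f (1, p k)) {x : E m}
    (hx : x ∈ convexHull ℝ (Set.range p)) : 0 ≤ f (1, x) := by
  obtain ⟨c, hc0, hc1, rfl⟩ := mem_convexHull_range_iff.1 hx
  rw [sum_apply_homogenize hc1]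
  exact Finset.sum_nonneg fun i _ => mul_nonneg (hc0 i) (hf i)

lemma isExposed_subset_iff {p : ι → E m} {F G : Set (E m)}
    (hF : IsExposed ℝ (convexHull ℝ (Set.range p)) F)
    (hG : IsExposed ℝ (convexHull ℝ (Set.range p)) G) :
    {k | p k ∈ F} ⊆ {k | p k ∈ G} ↔ F ⊆ G := by
  refine ⟨fun h x hx => ?_, fun h k hk => h hk⟩
  obtain ⟨f, hf, hFf⟩ := isExposed_convexHull_exists ⟨x, hx⟩ hF
  have hx' := hx
  rw [hFf] at hx'
  obtain ⟨hxP, hfx⟩ := hx'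
  obtain ⟨c, hc0, hc1, rfl⟩ := mem_convexHull_range_iff.1 hxP
  rw [sum_apply_homogenize hc1, Finset.sum_eq_zero_iff_of_nonneg
    fun i _ => mul_nonneg (hc0 i) (hf i)] at hfx
  have hmem : ∀ i, c i ≠ 0 → p i ∈ G := fun i hi => h (by
    have := (mul_eq_zero.1 (hfx i (Finset.mem_univ i))).resolve_left hi
    change p i ∈ F
    rw [hFf]
    exact ⟨subset_convexHull ℝ _ ⟨i, rfl⟩, this⟩)
  -- The weights sum to 1, so some vertex lies in `F`, hence in `G`; thus `G` is non-empty and has a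
  -- functional.
  obtain ⟨i, -, hi⟩ : ∃ i ∈ Finset.univ, c i ≠ 0 :=
    Finset.exists_ne_zero_of_sum_ne_zero (by rw [hc1]; exact one_ne_zero)
  obtain ⟨g, hg, hGg⟩ := isExposed_convexHull_exists ⟨_, hmem i hi⟩ hG
  rw [hGg]
  refine ⟨hxP, ?_⟩
  rw [sum_apply_homogenize hc1]
  refine Finset.sum_eq_zero fun k _ => ?_
  by_cases hk : c k = 0
  · simp [hk]
  · have := hmem k hk
    rw [hGg] at this
    simp [this.2]

lemma exists_isExposed_of_isFaceSet {p : ι → E m} {S : Set ι}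
    (hS : IsFaceSet (fun k => ((1 : ℝ), p k)) S) :
    ∃ F, IsExposed ℝ (convexHull ℝ (Set.range p)) F ∧ {k | p k ∈ F} = S := by
  obtain ⟨f, hf, hfS⟩ := hS
  refine ⟨{x ∈ convexHull ℝ (Set.range p) | f (1, x) = 0}, ?_, ?_⟩
  · rintro ⟨x₀, hx₀, hfx₀⟩
    have hsplit : ∀ x, f (1, x) = f (1, 0) + f (0, x) := fun x => by
      rw [← map_add]; simp
    refine ⟨LinearMap.toContinuousLinearMap (-(f ∘ₗ LinearMap.inr ℝ ℝ (E m))), ?_⟩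
    ext x
    constructor
    · rintro ⟨hx, h⟩
      refine ⟨hx, fun y hy => ?_⟩
      have := homogenize_nonneg hf hy
      rw [hsplit] at this h
      simp
      linarith
    · rintro ⟨hx, h⟩
      refine ⟨hx, ?_⟩
      have h1 := h x₀ hx₀
      have h2 := homogenize_nonneg hf hx
      rw [hsplit] at h2 hfx₀ ⊢
      simp at h1
      linarith
  · ext k
    rw [hfS]
    exact ⟨fun h => h.2, fun h => ⟨subset_convexHull ℝ _ ⟨k, rfl⟩, h⟩⟩

/-- The face lattice of a convex hull of finitely many points is that of the homogenized points. -/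
theorem nonempty_euclideanFaces_orderIso (p : ι → E m) :
    Nonempty (EuclideanFaces (convexHull ℝ (Set.range p)) ≃o
      FaceSets fun k => ((1 : ℝ), p k)) :=
  ⟨RelIso.ofSurjective
    (OrderEmbedding.ofMapLEIff
      (fun F : EuclideanFaces (convexHull ℝ (Set.range p)) =>
        (⟨{k | p k ∈ F.1}, isFaceSet_of_isExposed F.2⟩ : FaceSets fun k => ((1 : ℝ), p k)))
      fun F G => isExposed_subset_iff F.2 G.2)
    fun S => by
      obtain ⟨F, hF, h⟩ := exists_isExposed_of_isFaceSet S.2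
      exact ⟨⟨F, hF⟩, Subtype.ext h⟩⟩

end EuclideanFaces

/-! ### Faces of spherical polytopes as face sets of generators. -/

section SphericalFaces

variable {ι : Type*} {m : ℕ}

lemma vec_mem_hull (v : ι → E m) (k : ι) : v k ∈ PointedCone.hull ℝ (Set.range v) :=
  Submodule.subset_span ⟨k, rfl⟩

variable [Fintype ι]

/-- The spherical polytope spanned by the vectors `v k`. -/
def coneSection (v : ι → E m) : Set (E m) :=
  {x | x ∈ PointedCone.hull ℝ (Set.range v) ∧ ‖x‖ = 1}

lemma mem_hull_range_iff {v : ι → E m} {x : E m} :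
    x ∈ PointedCone.hull ℝ (Set.range v) ↔ ∃ c : ι → ℝ, (∀ i, 0 ≤ c i) ∧ ∑ i, c i • v i = x := by
  rw [PointedCone.hull, Submodule.mem_span_range_iff_exists_fun]
  constructor
  · rintro ⟨c, rfl⟩
    exact ⟨fun i => (c i : ℝ), fun i => (c i).2, rfl⟩
  · rintro ⟨c, hc, rfl⟩
    exact ⟨fun i => ⟨c i, hc i⟩, rfl⟩

lemma normalize_mem_coneSection {v : ι → E m} {x : E m}
    (hx : x ∈ PointedCone.hull ℝ (Set.range v)) (hne : x ≠ 0) :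
    ‖x‖⁻¹ • x ∈ coneSection v := by
  refine ⟨?_, by rw [norm_smul, norm_inv, norm_norm, inv_mul_cancel₀ (norm_ne_zero_iff.2 hne)]⟩
  obtain ⟨c, hc, rfl⟩ := mem_hull_range_iff.1 hx
  refine mem_hull_range_iff.2 ⟨fun i => ‖∑ i, c i • v i‖⁻¹ * c i,
    fun i => mul_nonneg (by positivity) (hc i), ?_⟩
  simp only [mul_smul, ← Finset.smul_sum]

lemma forall_coneSection_inner_nonpos_iff {v : ι → E m} (hv : ∀ k, v k ≠ 0) {a : E m} :
    (∀ x ∈ coneSection v, inner ℝ a x ≤ 0) ↔ ∀ k, inner ℝ a (v k) ≤ 0 := by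
  constructor
  · intro h k
    have := h _ (normalize_mem_coneSection (vec_mem_hull v k) (hv k))
    rw [inner_smul_right] at this
    have hpos : 0 < ‖v k‖⁻¹ := inv_pos.2 (norm_pos_iff.2 (hv k))
    exact nonpos_of_mul_nonpos_right this hpos
  · rintro h x ⟨hx, -⟩
    obtain ⟨c, hc, rfl⟩ := mem_hull_range_iff.1 hx
    rw [inner_sum]
    refine Finset.sum_nonpos fun i _ => ?_
    rw [inner_smul_right]
    exact mul_nonpos_of_nonneg_of_nonpos (hc i) (h i)

lemma inner_eq_zero_iff_of_mem_coneSection {v : ι → E m} {a : E m} (ha : ∀ k, inner ℝ a (v k) ≤ 0)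
    {c : ι → ℝ} (hc : ∀ i, 0 ≤ c i) :
    inner ℝ a (∑ i, c i • v i) = 0 ↔ ∀ i, c i ≠ 0 → inner ℝ a (v i) = 0 := by
  rw [inner_sum]
  simp only [inner_smul_right]
  rw [Finset.sum_eq_zero_iff_of_nonpos
    fun i _ => mul_nonpos_of_nonneg_of_nonpos (hc i) (ha i)]
  simp only [Finset.mem_univ, true_imp_iff, mul_eq_zero, or_iff_not_imp_left]

lemma cutsOut_subset {v : ι → E m} (hv : ∀ k, v k ≠ 0) {a b : E m} {F G : Set (E m)}
    (hF : CutsOut a (coneSection v) F) (hG : CutsOut b (coneSection v) G)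
    (h : ∀ k, inner ℝ a (v k) = 0 → inner ℝ b (v k) = 0) : F ⊆ G := by
  have ha := (forall_coneSection_inner_nonpos_iff hv).1 hF.1
  have hb := (forall_coneSection_inner_nonpos_iff hv).1 hG.1
  rw [hF.2, hG.2]
  rintro x ⟨hx, hax⟩
  refine ⟨hx, ?_⟩
  obtain ⟨c, hc, rfl⟩ := mem_hull_range_iff.1 hx.1
  rw [inner_eq_zero_iff_of_mem_coneSection ha hc] at hax
  rw [inner_eq_zero_iff_of_mem_coneSection hb hc]
  exact fun i hi => h i (hax i hi)

lemma CutsOut.normalize_mem_iff {v : ι → E m} (hv : ∀ k, v k ≠ 0) {a : E m} {F : Set (E m)}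
    (hF : CutsOut a (coneSection v) F) (k : ι) :
    ‖v k‖⁻¹ • v k ∈ F ↔ inner ℝ a (v k) = 0 := by
  rw [hF.2]
  have hne : ‖v k‖⁻¹ ≠ 0 := inv_ne_zero (norm_ne_zero_iff.2 (hv k))
  constructor
  · rintro ⟨-, h⟩
    rw [inner_smul_right] at h
    exact (mul_eq_zero.1 h).resolve_left hne
  · intro h
    exact ⟨normalize_mem_coneSection (vec_mem_hull v k) (hv k), by rw [inner_smul_right, h, mul_zero]⟩

lemma IsFaceSet.exists_cutsOut {v : ι → E m} (hv : ∀ k, v k ≠ 0) {S : Set ι}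
    (hS : IsFaceSet v S) :
    ∃ a F, CutsOut a (coneSection v) F ∧ ∀ k, k ∈ S ↔ inner ℝ a (v k) = 0 := by
  obtain ⟨f, hf, hfS⟩ := hS
  set b := (InnerProductSpace.toDual ℝ (E m)).symm (LinearMap.toContinuousLinearMap f)
  have hb : ∀ x, inner ℝ b x = f x := fun x => by simp [b]
  refine ⟨-b, {x ∈ coneSection v | inner ℝ (-b) x = 0}, ⟨?_, rfl⟩, fun k => ?_⟩
  · rw [forall_coneSection_inner_nonpos_iff hv]
    intro k
    rw [inner_neg_left, hb]
    linarith [hf k]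
  · rw [inner_neg_left, hb, neg_eq_zero, hfS]

lemma CutsOut.isFaceSet {v : ι → E m} (hv : ∀ k, v k ≠ 0) {a : E m} {F : Set (E m)}
    (hF : CutsOut a (coneSection v) F) : IsFaceSet v {k | inner ℝ a (v k) = 0} := by
  have ha := (forall_coneSection_inner_nonpos_iff hv).1 hF.1
  refine ⟨-(innerₛₗ ℝ a), fun k => ?_, fun k => ?_⟩
  · simpa using ha k
  · simp

/-- The face lattice of a spherical polytope is that of its generators. -/
theorem nonempty_sphericalFaces_orderIso {v : ι → E m} (hv : ∀ k, v k ≠ 0) :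
    Nonempty (SphericalFaces (coneSection v) ≃o FaceSets v) := by
  have hset : ∀ {a : E m} {F : Set (E m)}, CutsOut a (coneSection v) F →
      {k | ‖v k‖⁻¹ • v k ∈ F} = {k | inner ℝ a (v k) = 0} := fun hF =>
    Set.ext fun k => hF.normalize_mem_iff hv k
  refine ⟨RelIso.ofSurjective
    (OrderEmbedding.ofMapLEIff
      (fun F : SphericalFaces (coneSection v) =>
        (⟨{k | ‖v k‖⁻¹ • v k ∈ F.1}, ?_⟩ : FaceSets v)) ?_) ?_⟩
  · obtain ⟨a, ha⟩ := F.2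
    rw [hset ha]
    exact ha.isFaceSet hv
  · rintro ⟨F, a, ha⟩ ⟨G, b, hb⟩
    refine ⟨fun h => ?_, fun h k hk => h hk⟩
    refine cutsOut_subset hv ha hb fun k hk => ?_
    rw [← ha.normalize_mem_iff hv] at hk
    rw [← hb.normalize_mem_iff hv]
    exact h hk
  · rintro ⟨S, hS⟩
    obtain ⟨a, F, hF, h⟩ := hS.exists_cutsOut hv
    exact ⟨⟨F, a, hF⟩, Subtype.ext ((hset hF).trans (Set.ext fun k => (h k).symm))⟩

end SphericalFaces

/-! ### Curves of order d and their alternating sign. -/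

section Curves

variable {d : ℕ}

/-- The determinant as an alternating map on `ℝ × E d`. -/
noncomputable def homogeneousDet (d : ℕ) : (ℝ × E d) [⋀^Fin (d + 1)]→ₗ[ℝ] ℝ :=
  Matrix.detRowAlternating.compLinearMap
    { toFun := fun x => (Fin.cons x.1 x.2 : Fin (d + 1) → ℝ)
      map_add' := fun x y => by
        funext i
        refine Fin.cases ?_ (fun i => ?_) i <;> simp
      map_smul' := fun c x => by
        funext i
        refine Fin.cases ?_ (fun i => ?_) i <;> simp }

lemma homogeneousDet_apply (z : Fin (d + 1) → ℝ × E d) :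
    homogeneousDet d z =
      (Matrix.of fun i => (Fin.cons (z i).1 (z i).2 : Fin (d + 1) → ℝ)).det := rfl

/-- A kernel vector of the singular matrix would be an affine hyperplane met for d + 1 parameters.
-/
lemma IsCurveOfOrder.det_ne_zero {I : Set ℝ} {γ : ℝ → E d} (h : IsCurveOfOrder d I γ)
    {s : Fin (d + 1) → ℝ} (hs : StrictMono s) (hI : ∀ i, s i ∈ I) :
    homogeneousDet d (fun i => (1, γ (s i))) ≠ 0 := by
  intro h0
  rw [homogeneousDet_apply, ← Matrix.exists_mulVec_eq_zero_iff] at h0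
  obtain ⟨a, ha, hMa⟩ := h0
  have hrow : ∀ i, a 0 + ∑ j, γ (s i) j * a j.succ = 0 := fun i => by
    have := congrFun hMa i
    simpa [Matrix.mulVec, dotProduct, Fin.sum_univ_succ] using this
  set b : E d := WithLp.toLp 2 fun j => a j.succ with hb
  have hinner : ∀ i, inner ℝ b (γ (s i)) = -a 0 := fun i => by
    have := hrow i
    simp only [PiLp.inner_apply, RCLike.inner_apply, conj_trivial, hb]
    linarith
  have hb0 : b ≠ 0 := by
    rintro hb0
    have htail : ∀ j : Fin d, a j.succ = 0 := fun j => by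
      have := congrArg (fun z : E d => z j) hb0
      simpa [hb] using this
    refine ha (funext fun i => ?_)
    refine Fin.cases ?_ htail i
    have := hrow 0
    simpa [htail] using this
  have hcard := h.2.2 b (-a 0) hb0
  have hsub : Set.range s ⊆ {t ∈ I | inner ℝ b (γ t) = -a 0} := by
    rintro _ ⟨i, rfl⟩
    exact ⟨hI i, hinner i⟩
  have h1 := (Set.encard_le_encard hsub).trans hcard
  rw [← Set.image_univ, hs.injective.encard_image, Set.encard_univ, ENat.card_eq_coe_fintype_card,
    Fintype.card_fin] at h1
  have : d + 1 ≤ d := by exact_mod_cast h1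
  omega

lemma convex_strictMono_tuples {I : Set ℝ} (hI : I.OrdConnected) (n : ℕ) :
    Convex ℝ {s : Fin n → ℝ | StrictMono s ∧ ∀ i, s i ∈ I} := by
  rintro s ⟨hs, hsI⟩ t ⟨ht, htI⟩ a b ha hb hab
  refine ⟨fun i j hij => ?_, fun i => hI.convex (hsI i) (htI i) ha hb hab⟩
  have h1 := hs hij
  have h2 := ht hij
  simp only [Pi.add_apply, Pi.smul_apply, smul_eq_mul]
  rcases ha.eq_or_lt with rfl | ha
  · have : b = 1 := by linarith
    subst this
    linarith
  · nlinarith [mul_lt_mul_of_pos_left h1 ha, mul_le_mul_of_nonneg_left h2.le hb]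

/-- The determinant is continuous and has no zero on the convex, hence connected, set of increasing
tuples. -/
lemma IsCurveOfOrder.det_sign {I : Set ℝ} {γ : ℝ → E d} (h : IsCurveOfOrder d I γ) :
    (∀ s : Fin (d + 1) → ℝ, StrictMono s → (∀ i, s i ∈ I) →
      0 < homogeneousDet d fun i => (1, γ (s i))) ∨
    (∀ s : Fin (d + 1) → ℝ, StrictMono s → (∀ i, s i ∈ I) →
      homogeneousDet d (fun i => (1, γ (s i))) < 0) := by
  set X : Set (Fin (d + 1) → ℝ) := {s | StrictMono s ∧ ∀ i, s i ∈ I}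
  have hconn : IsPreconnected X := (convex_strictMono_tuples h.1 _).isPreconnected
  have hcont : ContinuousOn (fun s : Fin (d + 1) → ℝ => homogeneousDet d fun i => (1, γ (s i))) X := by
    simp only [homogeneousDet_apply]
    have : ContinuousOn (fun s : Fin (d + 1) → ℝ => Matrix.of fun i =>
        (Fin.cons 1 (γ (s i)) : Fin (d + 1) → ℝ)) X := by
      refine continuousOn_pi.2 fun i => continuousOn_pi.2 fun j => ?_
      refine Fin.cases ?_ (fun j => ?_) j
      · simpa using continuousOn_const
      · have h1 : ContinuousOn (fun s : Fin (d + 1) → ℝ => γ (s i)) X :=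
          h.2.1.comp (continuous_apply i).continuousOn fun s hs => hs.2 i
        exact (EuclideanSpace.proj (𝕜 := ℝ) j).continuous.comp_continuousOn h1
    exact (Continuous.matrix_det continuous_id).comp_continuousOn this
  by_contra! hcon
  obtain ⟨⟨s, hs, hsI, hs0⟩, ⟨t, ht, htI, ht0⟩⟩ := hcon
  obtain ⟨r, hr, hr0⟩ := hconn.intermediate_value (a := s) (b := t) ⟨hs, hsI⟩ ⟨ht, htI⟩ hcont
    ⟨hs0, ht0⟩
  exact h.det_ne_zero hr.1 hr.2 hr0

lemma IsCurveOfOrder.exists_endPositive {I : Set ℝ} {γ : ℝ → E d} (h : IsCurveOfOrder d I γ)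
    {M : ℕ} {t : Fin (M + 1) → ℝ} (ht : StrictMono t) (hI : ∀ k, t k ∈ I) :
    ∃ D : (ℝ × E d) [⋀^Fin (d + 1)]→ₗ[ℝ] ℝ, EndPositive D fun k => ((1 : ℝ), γ (t k)) := by
  rcases h.det_sign with h | h
  · exact ⟨homogeneousDet d, fun κ hκ _ => h (t ∘ κ) (ht.comp hκ) fun i => hI _⟩
  · exact ⟨-homogeneousDet d, fun κ hκ _ =>
      neg_pos.2 (h (t ∘ κ) (ht.comp hκ) fun i => hI _)⟩

/-- The face lattice of an odd-dimensional cyclic polytope is that of every end-positive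
configuration. -/
theorem IsCyclicType.nonempty_orderIso {n : ℕ} (hd : Odd d) {L : Type*} [PartialOrder L]
    {V : Type*} [AddCommGroup V] [Module ℝ V] [FiniteDimensional ℝ V] (hV : finrank ℝ V = d + 1)
    (hL : IsCyclicType d (n + 1) L) {D : V [⋀^Fin (d + 1)]→ₗ[ℝ] ℝ} {v : Fin (n + 1) → V}
    (hD : EndPositive D v) : Nonempty (FaceSets v ≃o L) := by
  obtain ⟨hdn, I, γ, t, hγ, ht, hI, ⟨e⟩⟩ := hL
  obtain ⟨D', hD'⟩ := hγ.exists_endPositive ht hI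
  obtain ⟨e'⟩ := nonempty_euclideanFaces_orderIso fun k => γ (t k)
  have hV' : finrank ℝ (ℝ × E d) = d + 1 := by
    rw [finrank_prod, finrank_self, finrank_euclideanSpace_fin, add_comm]
  have hdM : d ≤ n := by omega
  have heq : (fun S => IsFaceSet v S) = fun S => IsFaceSet (fun k => ((1 : ℝ), γ (t k))) S := by
    funext S
    rw [hD.isFaceSet_iff hd hdM hV, hD'.isFaceSet_iff hd hdM hV']
  have hcongr : Nonempty (FaceSets v ≃o FaceSets fun k => ((1 : ℝ), γ (t k))) :=
    ⟨{ toEquiv := Equiv.subtypeEquivRight fun S => iff_of_eq (congrFun heq S)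
       map_rel_iff' := Iff.rfl }⟩
  obtain ⟨e''⟩ := hcongr
  exact ⟨e''.trans (e'.symm.trans e.symm)⟩

end Curves

/-! ### Generalized Vandermonde determinants and expansions. -/

section Determinants

open Polynomial

/-- Synthetic division by X - s gives a quotient whose k-th coefficient is the sum of s^(i-k-1) g_i
over i > k. For s > 0 this preserves non-negativity of the high coefficients and lowers the
threshold by one; the roots are divided out one at a time. -/
lemma exists_eq_add_prod_mul {N : ℕ} {s : Fin N → ℝ} (hs : ∀ i, 0 < s i) {g : ℝ[X]}
    (hg : ∀ k, N ≤ k → 0 ≤ g.coeff k) (hpos : ∃ k, N ≤ k ∧ 0 < g.coeff k) :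
    ∃ r h : ℝ[X], r.degree < N ∧ (∀ k, 0 ≤ h.coeff k) ∧ (∃ k, 0 < h.coeff k) ∧
      g = r + (∏ i, (X - C (s i))) * h := by
  induction N generalizing g with
  | zero =>
    obtain ⟨k, -, hk⟩ := hpos
    exact ⟨0, g, by simp, fun k => hg k (Nat.zero_le k), ⟨k, hk⟩, by simp⟩
  | succ N ih =>
    set q := g /ₘ (X - C (s 0)) with hq
    have hqg : g = C (g.eval (s 0)) + (X - C (s 0)) * q := by
      rw [← modByMonic_X_sub_C_eq_C_eval, hq, modByMonic_add_div]
    have hterm : ∀ k, N ≤ k → ∀ i ∈ Finset.Icc (k + 1) g.natDegree,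
        0 ≤ s 0 ^ (i - (k + 1)) * g.coeff i := fun k hk i hi =>
      mul_nonneg (pow_nonneg (hs 0).le _) (hg i (by have := (Finset.mem_Icc.1 hi).1; omega))
    obtain ⟨r, h, hr, hh, hh', hqr⟩ := ih (s := fun i => s i.succ) (fun i => hs _) (g := q)
      (fun k hk => by
        rw [hq, coeff_divByMonic_X_sub_C]
        exact Finset.sum_nonneg (hterm k hk))
      (by
        obtain ⟨k, hk, hgk⟩ := hpos
        obtain ⟨k, rfl⟩ : ∃ l, k = l + 1 := ⟨k - 1, by omega⟩
        refine ⟨k, by omega, ?_⟩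
        rw [hq, coeff_divByMonic_X_sub_C]
        refine Finset.sum_pos' (hterm k (by omega)) ⟨k + 1, ?_, by simpa using hgk⟩
        exact Finset.mem_Icc.2 ⟨le_rfl, le_natDegree_of_ne_zero hgk.ne'⟩)
    refine ⟨C (g.eval (s 0)) + (X - C (s 0)) * r, h, ?_, hh, hh', ?_⟩
    · refine (degree_add_le _ _).trans_lt (max_lt ?_ ?_)
      · exact degree_C_le.trans_lt (by exact_mod_cast Nat.succ_pos N)
      · rw [degree_mul, degree_X_sub_C]
        by_cases hr0 : r = 0
        · simp [hr0]
        · rw [degree_eq_natDegree hr0] at hr ⊢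
          norm_cast at hr ⊢
          omega
    · rw [Fin.prod_univ_succ]
      nth_rewrite 1 [hqg]
      rw [hqr]
      ring

lemma eval_pos_of_coeff_nonneg {h : ℝ[X]} (h0 : ∀ k, 0 ≤ h.coeff k) (h1 : ∃ k, 0 < h.coeff k)
    {t : ℝ} (ht : 0 < t) : 0 < h.eval t := by
  obtain ⟨k, hk⟩ := h1
  rw [eval_eq_sum_range]
  refine Finset.sum_pos' (fun i _ => mul_nonneg (h0 i) (pow_nonneg ht.le _))
    ⟨k, ?_, mul_pos hk (pow_pos ht _)⟩
  have := le_natDegree_of_ne_zero hk.ne'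
  simp
  omega

lemma det_vandermonde_pos {N : ℕ} {t : Fin N → ℝ} (ht : StrictMono t) :
    0 < (Matrix.vandermonde t).det := by
  rw [Matrix.det_vandermonde]
  refine Finset.prod_pos fun i _ => Finset.prod_pos fun j hj => ?_
  simpa using ht (by simpa using hj)

/-- The functions `1, t, …, t^(N-1), g(t)` form a Chebyshev system on the positive half-line when
the coefficients of the polynomial `g` in degrees at least `N` are non-negative. -/
lemma det_powers_eval_pos {N : ℕ} {t : Fin (N + 1) → ℝ} (ht : StrictMono t) (ht0 : ∀ i, 0 < t i)
    {g : ℝ[X]} (hg : ∀ k, N ≤ k → 0 ≤ g.coeff k) (hpos : ∃ k, N ≤ k ∧ 0 < g.coeff k) :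
    0 < (Matrix.of fun i => (Fin.snoc (fun j : Fin N => t i ^ (j : ℕ)) (g.eval (t i)) :
      Fin (N + 1) → ℝ)).det := by
  set A : Matrix (Fin (N + 1)) (Fin (N + 1)) ℝ :=
    Matrix.of fun i => (Fin.snoc (fun j : Fin N => t i ^ (j : ℕ)) (g.eval (t i))) with hA
  obtain ⟨r, h, hr, hh, hh', hgr⟩ :=
    exists_eq_add_prod_mul (s := fun i => t i.castSucc) (fun i => ht0 _) hg hpos
  -- Subtracting the remainder `r`, a combination of the power columns, makes the last column vanish
  -- except in the last row.
  have hdet := A.det_updateCol_sum (Fin.last N) (Fin.snoc (fun j : Fin N => -r.coeff j) 1)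
  rw [Fin.snoc_last, one_smul] at hdet
  have hcol : (fun k => ∑ i, (Fin.snoc (fun j : Fin N => -r.coeff j) 1 : Fin (N + 1) → ℝ) i • A k i)
      = fun k => (∏ i : Fin N, (t k - t i.castSucc)) * h.eval (t k) := by
    funext k
    have hreval : r.eval (t k) = ∑ j : Fin N, r.coeff j * t k ^ (j : ℕ) := by
      rw [eval_eq_sum, ← Polynomial.sum_fin (fun j a => a * t k ^ j) (by simp) hr]
    have h1 := congrArg (eval (t k)) hgr
    rw [eval_add, eval_mul, eval_prod] at h1
    simp only [eval_sub, eval_X, eval_C] at h1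
    rw [Fin.sum_univ_castSucc]
    simp only [hA, Matrix.of_apply, Fin.snoc_castSucc, Fin.snoc_last, smul_eq_mul, one_mul,
      neg_mul, Finset.sum_neg_distrib]
    rw [← hreval, h1]
    ring
  rw [hcol, Matrix.det_succ_column _ (Fin.last N), Fin.sum_univ_castSucc,
    Finset.sum_eq_zero, zero_add] at hdet
  · rw [← hdet, Matrix.updateCol_self]
    have hsub : (A.updateCol (Fin.last N) fun k =>
        (∏ i : Fin N, (t k - t i.castSucc)) * h.eval (t k)).submatrix
          (Fin.last N).succAbove (Fin.last N).succAbove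
        = Matrix.vandermonde fun i : Fin N => t i.castSucc := by
      ext i j
      simp [hA, Matrix.vandermonde_apply]
    rw [hsub, ← two_mul, pow_mul, neg_one_sq, one_pow, one_mul]
    refine mul_pos (mul_pos (Finset.prod_pos fun i _ => ?_)
      (eval_pos_of_coeff_nonneg hh hh' (ht0 _)))
      (det_vandermonde_pos fun i j hij => ht (by simpa using hij))
    simpa using ht (Fin.castSucc_lt_last i)
  · intro k _
    have : ∏ i : Fin N, (t k.castSucc - t i.castSucc) = 0 :=
      Finset.prod_eq_zero (Finset.mem_univ k) (sub_self _)
    rw [Matrix.updateCol_self, this]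
    simp

lemma det_snoc_of_ends {N : ℕ} (R : Fin (N + 2) → Fin (N + 1) → ℝ) {s : Fin (N + 2) → ℝ}
    (hs : ∀ i, i ≠ 0 → i ≠ Fin.last (N + 1) → s i = 0) :
    (Matrix.of fun i => (Fin.snoc (R i) (s i) : Fin (N + 2) → ℝ)).det =
      (-1) ^ (N + 1) * s 0 * (Matrix.of fun i : Fin (N + 1) => R i.succ).det +
        s (Fin.last (N + 1)) * (Matrix.of fun i : Fin (N + 1) => R i.castSucc).det := by
  rw [Matrix.det_succ_column _ (Fin.last (N + 1)), Fin.sum_univ_succ, Fin.sum_univ_castSucc,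
    Finset.sum_eq_zero, zero_add]
  · congr 1
    · have : (Matrix.of fun i => (Fin.snoc (R i) (s i) : Fin (N + 2) → ℝ)).submatrix
          (Fin.succAbove 0) (Fin.last (N + 1)).succAbove = Matrix.of fun i => R i.succ := by
        ext i j
        simp
      rw [this]
      simp
    · have : (Matrix.of fun i => (Fin.snoc (R i) (s i) : Fin (N + 2) → ℝ)).submatrix
          (Fin.last N).succ.succAbove (Fin.last (N + 1)).succAbove =
            Matrix.of fun i => R i.castSucc := by
        ext i j
        simp
      rw [this]
      simp [← two_mul, pow_mul]
  · intro i _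
    have : s i.castSucc.succ = 0 := hs _ (Fin.succ_ne_zero _) (by
      rw [Fin.ne_iff_vne]; simp; omega)
    simp [this]

lemma det_snoc_row {N : ℕ} (R : Fin N → Fin N → ℝ) (g : Fin N → ℝ) :
    (Matrix.of (Fin.snoc (fun i => (Fin.snoc (R i) (g i) : Fin (N + 1) → ℝ))
      (Fin.snoc 0 1 : Fin (N + 1) → ℝ) : Fin (N + 1) → Fin (N + 1) → ℝ)).det =
      (Matrix.of R).det := by
  rw [Matrix.det_succ_row _ (Fin.last N), Fin.sum_univ_castSucc, Finset.sum_eq_zero, zero_add]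
  · have : (Matrix.of (Fin.snoc (fun i => (Fin.snoc (R i) (g i) : Fin (N + 1) → ℝ))
        (Fin.snoc 0 1 : Fin (N + 1) → ℝ) : Fin (N + 1) → Fin (N + 1) → ℝ)).submatrix
          (Fin.last N).succAbove (Fin.last N).succAbove = Matrix.of R := by
      ext i j
      simp
    rw [this]
    simp [← two_mul, pow_mul]
  · intro j _
    simp

lemma det_cons_row {N : ℕ} (R : Fin N → Fin N → ℝ) (g : Fin N → ℝ) :
    (Matrix.of (Fin.cons (Fin.snoc 0 1 : Fin (N + 1) → ℝ)
      (fun i => (Fin.snoc (R i) (g i) : Fin (N + 1) → ℝ)) : Fin (N + 1) → Fin (N + 1) → ℝ)).det =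
      (-1) ^ N * (Matrix.of R).det := by
  rw [Matrix.det_succ_row _ 0, Fin.sum_univ_castSucc, Finset.sum_eq_zero, zero_add]
  · have : (Matrix.of (Fin.cons (Fin.snoc 0 1 : Fin (N + 1) → ℝ)
        (fun i => (Fin.snoc (R i) (g i) : Fin (N + 1) → ℝ)) :
          Fin (N + 1) → Fin (N + 1) → ℝ)).submatrix
          (Fin.succAbove 0) (Fin.last N).succAbove = Matrix.of R := by
      ext i j
      simp
    rw [this]
    simp
  · intro j _
    simp

end Determinants

/-! ### Signs of the end minors in adapted coordinates. -/

section Rows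

open Polynomial

variable {D M : ℕ}

/-- Half the squared norm of `(t, …, t^D)`, lowered by `c`. -/
noncomputable def heightPoly (D : ℕ) (c : ℝ) : ℝ[X] :=
  C (1 / 2) * ∑ i : Fin D, X ^ (2 * ((i : ℕ) + 1)) - C c

lemma heightPoly_coeff (D : ℕ) (c : ℝ) {k : ℕ} (hk : k ≠ 0) :
    (heightPoly D c).coeff k =
      1 / 2 * ∑ i : Fin D, if k = 2 * ((i : ℕ) + 1) then (1 : ℝ) else 0 := by
  rw [heightPoly, coeff_sub, coeff_C_mul, finsetSum_coeff, coeff_C_of_ne_zero hk, sub_zero]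
  simp only [coeff_X_pow]

lemma heightPoly_coeff_nonneg (D : ℕ) (c : ℝ) {k : ℕ} (hk : k ≠ 0) :
    0 ≤ (heightPoly D c).coeff k := by
  rw [heightPoly_coeff D c hk]
  refine mul_nonneg (by norm_num) (Finset.sum_nonneg fun i _ => ?_)
  split_ifs <;> norm_num

lemma heightPoly_coeff_pos (hD : 0 < D) (c : ℝ) : 0 < (heightPoly D c).coeff (2 * D) := by
  rw [heightPoly_coeff D c (by omega)]
  refine mul_pos (by norm_num) (Finset.sum_pos' (fun i _ => ?_)
    ⟨⟨D - 1, by omega⟩, Finset.mem_univ _, ?_⟩)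
  · split_ifs <;> norm_num
  · rw [if_pos (by simp; omega)]
    norm_num

/-- The first `D + 2` coordinates of the vertices of the scribed cyclic polytope, in an adapted
basis. -/
noncomputable def frontRow (D M : ℕ) (c : ℝ) (k : ℕ) : Fin (D + 2) → ℝ :=
  if k = 0 ∨ k = M then Fin.snoc 0 1
  else Fin.snoc (fun j : Fin (D + 1) => (k : ℝ) ^ (j : ℕ)) ((heightPoly D c).eval (k : ℝ))

/-- The last coordinate of the vertices of the scribed cyclic polytope, in an adapted basis. -/
noncomputable def lastCoord (M : ℕ) (h : ℝ) (k : ℕ) : ℝ :=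
  if k = 0 then h else if k = M then -h else 0

lemma det_frontRow_sites_pos (hD : 0 < D) (c : ℝ) {κ : Fin (D + 2) → ℕ} (hκ : StrictMono κ)
    (h0 : ∀ i, κ i ≠ 0) (hM : ∀ i, κ i ≠ M) :
    0 < (Matrix.of fun i => frontRow D M c (κ i)).det := by
  have : (fun i => frontRow D M c (κ i)) = fun i => (Fin.snoc
      (fun j : Fin (D + 1) => (κ i : ℝ) ^ (j : ℕ)) ((heightPoly D c).eval (κ i : ℝ)) :
        Fin (D + 2) → ℝ) := by
    funext i
    rw [frontRow, if_neg (by simp [h0, hM])]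
  rw [this]
  exact det_powers_eval_pos (t := fun i => (κ i : ℝ)) (Nat.strictMono_cast.comp hκ)
    (fun i => by exact_mod_cast Nat.pos_of_ne_zero (h0 i))
    (fun k hk => heightPoly_coeff_nonneg D c (by omega))
    ⟨2 * D, by omega, heightPoly_coeff_pos hD c⟩

lemma det_powers_pos {N : ℕ} {κ : Fin N → ℕ} (hκ : StrictMono κ) :
    0 < (Matrix.of fun i => fun j : Fin N => (κ i : ℝ) ^ (j : ℕ)).det :=
  det_vandermonde_pos (t := fun i => (κ i : ℝ)) fun _ _ hij => Nat.cast_lt.2 (hκ hij)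

/-- The minor left after deleting the first row. If its last row is an apex, namely (0, …, 0, 1), it
reduces to a Vandermonde determinant. -/
lemma det_frontRow_succ_pos (hD : 0 < D) (c : ℝ) {κ : Fin (D + 2) → ℕ} (hκ : StrictMono κ)
    (h0 : ∀ i, κ i ≠ 0) (hM : ∀ i, κ i ≤ M) :
    0 < (Matrix.of fun i => frontRow D M c (κ i)).det := by
  by_cases hlast : κ (Fin.last (D + 1)) = M
  · have hlt : ∀ i : Fin (D + 1), κ i.castSucc ≠ M := fun i => by
      have := hκ (Fin.castSucc_lt_last i)
      omega
    have : (fun i => frontRow D M c (κ i)) = Fin.snoc (fun i : Fin (D + 1) => (Fin.snoc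
        (fun j : Fin (D + 1) => (κ i.castSucc : ℝ) ^ (j : ℕ))
          ((heightPoly D c).eval (κ i.castSucc : ℝ)) : Fin (D + 2) → ℝ))
        (Fin.snoc 0 1 : Fin (D + 2) → ℝ) := by
      funext i
      refine Fin.lastCases ?_ (fun i => ?_) i
      · rw [Fin.snoc_last, frontRow, if_pos (Or.inr hlast)]
      · rw [Fin.snoc_castSucc, frontRow, if_neg (by simp [h0, hlt])]
    rw [this, det_snoc_row]
    exact det_powers_pos (hκ.comp Fin.strictMono_castSucc)
  · refine det_frontRow_sites_pos hD c hκ h0 fun i => ?_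
    have := hκ.monotone (Fin.le_last i)
    have := hM (Fin.last _)
    omega

/-- An apex as top row contributes the sign (-1)^(D+1), which is 1 because D is odd. -/
lemma det_frontRow_castSucc_pos (hD : Odd D) (c : ℝ) {κ : Fin (D + 2) → ℕ} (hκ : StrictMono κ)
    (hM : ∀ i, κ i ≠ M) :
    0 < (Matrix.of fun i => frontRow D M c (κ i)).det := by
  by_cases hzero : κ 0 = 0
  · have hpos : ∀ i : Fin (D + 1), κ i.succ ≠ 0 := fun i => by
      have := hκ (Fin.succ_pos i)
      omega
    have : (fun i => frontRow D M c (κ i)) = Fin.cons (Fin.snoc 0 1 : Fin (D + 2) → ℝ)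
        (fun i : Fin (D + 1) => (Fin.snoc
        (fun j : Fin (D + 1) => (κ i.succ : ℝ) ^ (j : ℕ))
          ((heightPoly D c).eval (κ i.succ : ℝ)) : Fin (D + 2) → ℝ)) := by
      funext i
      refine Fin.cases ?_ (fun i => ?_) i
      · rw [Fin.cons_zero, frontRow, if_pos (Or.inl hzero)]
      · rw [Fin.cons_succ, frontRow, if_neg (by simp [hpos, hM])]
    rw [this, det_cons_row, hD.add_one.neg_one_pow, one_mul]
    exact det_powers_pos (hκ.comp (Fin.strictMono_succ))
  · refine det_frontRow_sites_pos hD.pos c hκ (fun i => ?_) hM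
    have := hκ.monotone (Fin.zero_le i)
    omega

/-- The last column is non-zero only at apices. Expanding along it gives at most two terms: h enters
with sign (-1)^(D+2) = -1 and -h with sign +1. The opposite heights of the apices thus make both
terms negative, and `hend` provides at least one of them. -/
lemma det_rows_neg (hD : Odd D) (c : ℝ) {h : ℝ} (hh : 0 < h) {κ : Fin (D + 3) → Fin (M + 1)}
    (hκ : StrictMono κ) (hend : κ 0 = 0 ∨ κ (Fin.last (D + 2)) = Fin.last M) :
    (Matrix.of fun i => (Fin.snoc (frontRow D M c (κ i)) (lastCoord M h (κ i)) :
      Fin (D + 3) → ℝ)).det < 0 := by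
  have hκ' : StrictMono fun i => (κ i : ℕ) := hκ
  have hM0 : M ≠ 0 := by
    have h1 : (κ 0 : ℕ) < κ (Fin.last (D + 2)) := hκ (Fin.last_pos)
    have := (κ (Fin.last (D + 2))).is_lt
    omega
  have hne0 : ∀ i, i ≠ 0 → (κ i : ℕ) ≠ 0 := fun i hi => by
    have : (κ 0 : ℕ) < κ i := hκ (Fin.pos_of_ne_zero hi)
    omega
  have hneM : ∀ i, i ≠ Fin.last (D + 2) → (κ i : ℕ) ≠ M := fun i hi => by
    have h1 : (κ i : ℕ) < κ (Fin.last (D + 2)) := hκ (Fin.lt_last_iff_ne_last.2 hi)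
    have := (κ (Fin.last (D + 2))).is_lt
    omega
  rw [det_snoc_of_ends (fun i => frontRow D M c (κ i)) (s := fun i => lastCoord M h (κ i))
    fun i hi hi' => by simp [lastCoord, hne0 i hi, hneM i hi']]
  have h1 := det_frontRow_succ_pos hD.pos c (κ := fun i => (κ i.succ : ℕ)) (M := M)
    (hκ'.comp Fin.strictMono_succ) (fun i => hne0 _ (Fin.succ_ne_zero i))
    (fun i => Nat.lt_succ_iff.1 (κ i.succ).is_lt)
  have h2 := det_frontRow_castSucc_pos hD c (κ := fun i => (κ i.castSucc : ℕ)) (M := M)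
    (hκ'.comp Fin.strictMono_castSucc) (fun i => hneM _ (Fin.castSucc_lt_last i).ne)
  have hsgn : (-1 : ℝ) ^ (D + 1 + 1) = -1 := by
    rw [pow_add, hD.add_one.neg_one_pow]; norm_num
  have hs0 : 0 ≤ lastCoord M h (κ 0) := by
    have := hneM 0 (Fin.last_pos.ne)
    rw [lastCoord, if_neg this]
    split_ifs <;> simp [hh.le]
  have hs1 : lastCoord M h (κ (Fin.last (D + 2))) ≤ 0 := by
    have := hne0 _ (Fin.last_pos (n := D + 1)).ne'
    rw [lastCoord, if_neg this]
    split_ifs <;> simp [hh.le]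
  rw [hsgn]
  rcases hend with h0 | h0
  · have : lastCoord M h (κ 0) = h := by simp [lastCoord, h0]
    nlinarith [mul_pos hh h1, mul_nonneg (neg_nonneg.2 hs1) h2.le]
  · have : lastCoord M h (κ (Fin.last (D + 2))) = -h := by simp [lastCoord, h0, hM0]
    nlinarith [mul_pos hh h2, mul_nonneg hs0 h1.le]

end Rows

/-! ### Pointedness, spans and relative interiors of cone sections. -/

section ConeSections

variable {ι : Type*} [Fintype ι] {m : ℕ} {v : ι → E m}

lemma neg_notMem_hull_of_inner_pos {a : E m} (ha : ∀ k, 0 < inner ℝ a (v k)) {x : E m}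
    (hx : x ∈ PointedCone.hull ℝ (Set.range v)) (hx0 : x ≠ 0) :
    -x ∉ PointedCone.hull ℝ (Set.range v) := by
  intro hnx
  obtain ⟨c, hc, hcx⟩ := mem_hull_range_iff.1 hx
  obtain ⟨c', hc', hcx'⟩ := mem_hull_range_iff.1 hnx
  have hinner : ∀ w : ι → ℝ, inner ℝ a (∑ i, w i • v i) = ∑ i, w i * inner ℝ a (v i) := fun w => by
    simp [inner_sum, inner_smul_right]
  have h1 : 0 ≤ inner ℝ a (-x) := by
    rw [← hcx', hinner]
    exact Finset.sum_nonneg fun i _ => mul_nonneg (hc' i) (ha i).le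
  rw [inner_neg_right] at h1
  have h2 : ∑ i, c i * inner ℝ a (v i) = 0 := by
    refine le_antisymm ?_ (Finset.sum_nonneg fun i _ => mul_nonneg (hc i) (ha i).le)
    rw [← hinner, hcx]
    linarith
  rw [Finset.sum_eq_zero_iff_of_nonneg fun i _ => mul_nonneg (hc i) (ha i).le] at h2
  refine hx0 ?_
  rw [← hcx]
  refine Finset.sum_eq_zero fun i hi => ?_
  rw [(mul_eq_zero.1 (h2 i hi)).resolve_right (ha i).ne', zero_smul]

lemma CutsOut.span_eq (hv : ∀ k, v k ≠ 0) {a : E m} {F : Set (E m)}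
    (hF : CutsOut a (coneSection v) F) :
    Submodule.span ℝ F = Submodule.span ℝ (v '' {k | inner ℝ a (v k) = 0}) := by
  apply le_antisymm
  · refine Submodule.span_le.2 fun x hx => ?_
    have ha := (forall_coneSection_inner_nonpos_iff hv).1 hF.1
    rw [hF.2] at hx
    obtain ⟨c, hc, rfl⟩ := mem_hull_range_iff.1 hx.1.1
    have hz := (inner_eq_zero_iff_of_mem_coneSection ha hc).1 hx.2
    refine Submodule.sum_mem _ fun i _ => ?_
    by_cases hi : c i = 0
    · simp [hi]
    · exact Submodule.smul_mem _ _ (Submodule.subset_span ⟨i, hz i hi, rfl⟩)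
  · refine Submodule.span_le.2 ?_
    rintro _ ⟨k, hk, rfl⟩
    have hmem := (hF.normalize_mem_iff hv k).2 hk
    have := Submodule.smul_mem _ ‖v k‖ (Submodule.subset_span (R := ℝ) hmem)
    rwa [smul_smul, mul_inv_cancel₀ (norm_ne_zero_iff.2 (hv k)), one_smul] at this

lemma span_coneSection (hv : ∀ k, v k ≠ 0) :
    Submodule.span ℝ (coneSection v) = Submodule.span ℝ (Set.range v) := by
  have h : CutsOut 0 (coneSection v) (coneSection v) := ⟨by simp, by simp⟩
  rw [h.span_eq hv]
  simp

/-- Positive combinations of all the generators of a face lie in its relative interior. -/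
lemma CutsOut.mem_sphericalRelint (hv : ∀ k, v k ≠ 0) {a : E m} {F : Set (E m)}
    (hF : CutsOut a (coneSection v) F) {S : Set ι} [Fintype S]
    (hS : S = {k | inner ℝ a (v k) = 0})
    {c : S → ℝ} (hc : ∀ k, 0 < c k)
    (hnorm : ‖∑ k, c k • v k‖ = 1) : ∑ k, c k • v k ∈ sphericalRelint F := by
  classical
  set φ := Fintype.linearCombination ℝ (fun k : S => v k) with hφ
  have hφc : ∀ w : S → ℝ, φ w = ∑ k, w k • v k := fun w => by
    rw [hφ, Fintype.linearCombination_apply]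
  have hrange : LinearMap.range φ = Submodule.span ℝ F := by
    rw [hφ, Fintype.range_linearCombination, hF.span_eq hv, ← hS, Set.image_eq_range]
  have hmem : ∀ w : S → ℝ, (∀ k, 0 < w k) → ‖φ w‖ = 1 → φ w ∈ F := by
    intro w hw h1
    rw [hF.2]
    refine ⟨⟨?_, h1⟩, ?_⟩
    · rw [hφc]
      exact Submodule.sum_mem _ fun k _ =>
        Submodule.smul_mem _ (⟨w k, (hw k).le⟩ : {r : ℝ // 0 ≤ r}) (vec_mem_hull v k)
    · rw [hφc, inner_sum]
      refine Finset.sum_eq_zero fun k _ => ?_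
      rw [inner_smul_right, show inner ℝ a (v k) = 0 from hS.subset k.2, mul_zero]
  -- A linear map onto its finite-dimensional range is open, so the strictly positive combinations
  -- form an open subset of the span of `F`.
  have hopen : IsOpen (φ.rangeRestrict '' {w | ∀ k, 0 < w k}) := by
    refine LinearMap.isOpenMap_of_finiteDimensional _ φ.surjective_rangeRestrict _ ?_
    simp only [Set.ofPred_forall]
    exact isOpen_iInter_of_finite fun k => isOpen_lt continuous_const (continuous_apply k)
  obtain ⟨ε, hε, hball⟩ := Metric.isOpen_iff.1 hopen _ ⟨c, hc, rfl⟩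
  rw [← hφc c] at hnorm ⊢
  refine ⟨hmem c hc hnorm, ε, hε, fun y hy hy1 hdist => ?_⟩
  rw [← hrange] at hy
  obtain ⟨w, hw, hwy⟩ := hball (show (⟨y, hy⟩ : LinearMap.range φ) ∈ _ from hdist)
  have : φ w = y := congrArg Subtype.val hwy
  rw [← this] at hy1 ⊢
  exact hmem w hw hy1

end ConeSections

/-! ### Causal vectors, avoiding and cutting. -/

section Lorentz

variable {d : ℕ}

lemma lorentz_add_left (x y z : E (d + 1)) : lorentz (x + y) z = lorentz x z + lorentz y z := by
  simp only [lorentz, PiLp.add_apply, add_mul, Finset.sum_add_distrib]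
  ring

lemma lorentz_smul_left (r : ℝ) (x z : E (d + 1)) : lorentz (r • x) z = r * lorentz x z := by
  simp only [lorentz, PiLp.smul_apply, smul_eq_mul, mul_assoc, ← Finset.mul_sum]
  ring

lemma lorentz_comm (x y : E (d + 1)) : lorentz x y = lorentz y x := by
  simp only [lorentz, mul_comm]

lemma lorentz_add_right (x y z : E (d + 1)) : lorentz x (y + z) = lorentz x y + lorentz x z := by
  rw [lorentz_comm, lorentz_add_left, lorentz_comm y, lorentz_comm z]

lemma lorentz_smul_right (r : ℝ) (x z : E (d + 1)) : lorentz x (r • z) = r * lorentz x z := by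
  rw [lorentz_comm, lorentz_smul_left, lorentz_comm z]

/-- Two future-directed causal vectors have a non-positive Lorentzian product. -/
lemma lorentz_nonpos {x y : E (d + 1)} (hx : lorentz x x ≤ 0) (hx0 : 0 ≤ x 0)
    (hy : lorentz y y ≤ 0) (hy0 : 0 ≤ y 0) : lorentz x y ≤ 0 := by
  simp only [lorentz] at hx hy ⊢
  have hcs := Finset.sum_mul_sq_le_sq_mul_sq Finset.univ (fun i : Fin d => x i.succ)
    fun i => y i.succ
  simp only [sq] at hcs
  have hxs : 0 ≤ ∑ i : Fin d, x i.succ * x i.succ :=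
    Finset.sum_nonneg fun i _ => mul_self_nonneg _
  have hys : 0 ≤ ∑ i : Fin d, y i.succ * y i.succ :=
    Finset.sum_nonneg fun i _ => mul_self_nonneg _
  have h1 : (∑ i : Fin d, x i.succ * y i.succ) ^ 2 ≤ (x 0 * y 0) ^ 2 := by
    calc (∑ i : Fin d, x i.succ * y i.succ) ^ 2 ≤ _ := by rw [sq]; exact hcs
      _ ≤ (x 0 * x 0) * (y 0 * y 0) := mul_le_mul (by linarith) (by linarith) hys
          (mul_self_nonneg _)
      _ = _ := by ring
  have := abs_le_of_sq_le_sq' h1 (mul_nonneg hx0 hy0)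
  linarith [this.2]

lemma exists_inner_eq_lorentz (T : E (d + 1)) : ∃ a : E (d + 1), ∀ z, inner ℝ a z = lorentz T z := by
  refine ⟨WithLp.toLp 2 (Fin.cons (-T 0) fun i => T i.succ), fun z => ?_⟩
  simp only [PiLp.inner_apply, RCLike.inner_apply, conj_trivial, Fin.sum_univ_succ, Fin.cons_zero,
    Fin.cons_succ, lorentz]
  congr 1
  · ring
  · exact Finset.sum_congr rfl fun i _ => mul_comm _ _

/-- Causal vectors with positive time coordinate. -/
def IsFuture (x : E (d + 1)) : Prop := lorentz x x ≤ 0 ∧ 0 < x 0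

lemma IsFuture.add {x y : E (d + 1)} (hx : IsFuture x) (hy : IsFuture y) : IsFuture (x + y) := by
  refine ⟨?_, by rw [PiLp.add_apply]; exact add_pos hx.2 hy.2⟩
  rw [lorentz_add_left, lorentz_add_right, lorentz_add_right, lorentz_comm y x]
  linarith [lorentz_nonpos hx.1 hx.2.le hy.1 hy.2.le, hx.1, hy.1]

lemma IsFuture.sum {ι : Type*} {s : Finset ι} (hs : s.Nonempty) {f : ι → E (d + 1)}
    (h : ∀ i ∈ s, IsFuture (f i)) : IsFuture (∑ i ∈ s, f i) := by
  classical
  induction hs using Finset.Nonempty.cons_induction with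
  | singleton i => simpa using h
  | cons i s hi hs ih =>
    rw [Finset.sum_cons]
    exact (h i (Finset.mem_cons_self i s)).add (ih fun j hj => h j (Finset.mem_cons_of_mem hj))

lemma IsFuture.ne_zero {x : E (d + 1)} (hx : IsFuture x) : x ≠ 0 := by
  rintro rfl
  exact hx.2.ne' rfl

lemma IsFuture.normalize_mem_cap {x : E (d + 1)} (hx : IsFuture x) : ‖x‖⁻¹ • x ∈ cap d := by
  refine ⟨?_, ?_, ?_⟩
  · rw [lorentz_smul_left, lorentz_smul_right, ← mul_assoc]
    exact mul_nonpos_of_nonneg_of_nonpos (by positivity) hx.1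
  · rw [PiLp.smul_apply, smul_eq_mul]
    exact mul_nonneg (by positivity) hx.2.le
  · rw [norm_smul, norm_inv, norm_norm, inv_mul_cancel₀ (norm_ne_zero_iff.2 hx.ne_zero)]

variable {ι : Type*} [Fintype ι] {v : ι → E (d + 1)}

/-- A causal vector whose Lorentzian products with the generators single out those of a face
shows that this face strongly avoids the sphere. -/
lemma CutsOut.stronglyAvoids (hv : ∀ k, v k ≠ 0) {a : E (d + 1)} {F : Set (E (d + 1))}
    (hF : CutsOut a (coneSection v) F) (hne : ∃ k, inner ℝ a (v k) ≠ 0) {T : E (d + 1)}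
    (hT : IsFuture T)
    (hTv : ∀ k, lorentz T (v k) ≤ 0 ∧ (lorentz T (v k) = 0 ↔ inner ℝ a (v k) = 0)) :
    StronglyAvoids (coneSection v) F := by
  obtain ⟨b, hb⟩ := exists_inner_eq_lorentz T
  have hcut : CutsOut b (coneSection v) {x ∈ coneSection v | inner ℝ b x = 0} :=
    ⟨(forall_coneSection_inner_nonpos_iff hv).2 fun k => by rw [hb]; exact (hTv k).1, rfl⟩
  have hiff : ∀ k, inner ℝ b (v k) = 0 ↔ inner ℝ a (v k) = 0 := fun k => by rw [hb, (hTv k).2]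
  have hFeq : F = {x ∈ coneSection v | inner ℝ b x = 0} :=
    (cutsOut_subset hv hF hcut fun k => (hiff k).2).antisymm
      (cutsOut_subset hv hcut hF fun k => (hiff k).1)
  refine ⟨b, ?_, hFeq ▸ hcut, fun x hx => ?_⟩
  · rintro rfl
    obtain ⟨k, hk⟩ := hne
    exact hk ((hiff k).1 (inner_zero_left _))
  · rw [hb]
    exact lorentz_nonpos hT.1 hT.2.le hx.1 hx.2.1

/-- A face strongly cuts the sphere if one of its generators sees all the others along causal
directions. -/
lemma CutsOut.stronglyCuts (hv : ∀ k, v k ≠ 0) {a : E (d + 1)} {F : Set (E (d + 1))}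
    (hF : CutsOut a (coneSection v) F) {k₀ k₁ : ι} (hk₀ : inner ℝ a (v k₀) = 0)
    (hk₁ : inner ℝ a (v k₁) = 0) (hk : k₁ ≠ k₀)
    (hfut : ∀ k, k ≠ k₀ → ∃ r : ℝ, 0 < r ∧ IsFuture (v k + r • v k₀)) : StronglyCuts F := by
  classical
  choose! r hr hfut using hfut
  set S := {k | inner ℝ a (v k) = 0} with hS
  set s₀ : S := ⟨k₀, hk₀⟩
  set A : Finset S := Finset.univ.erase s₀ with hA
  have hne : A.Nonempty := ⟨⟨k₁, hk₁⟩, by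
    rw [hA, Finset.mem_erase]
    exact ⟨fun h => hk (congrArg Subtype.val h), Finset.mem_univ _⟩⟩
  have hAne : ∀ k ∈ A, (k : ι) ≠ k₀ := fun k hk h =>
    (Finset.mem_erase.1 hk).1 (Subtype.ext h)
  -- A sum of future vectors in which every generator of the face has a positive coefficient; that
  -- of `v k₀` is the sum of the `r k`.
  set x := ∑ k ∈ A, (v k + r k • v k₀) with hx
  have hxfut : IsFuture x := IsFuture.sum hne fun k hk => hfut k (hAne k hk)
  set c : S → ℝ := fun k => if k = s₀ then ∑ k ∈ A, r k else 1 with hc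
  have hxc : ∑ k, c k • v k = x := by
    rw [← Finset.add_sum_erase _ _ (Finset.mem_univ s₀), hx, Finset.sum_add_distrib,
      ← Finset.sum_smul,
      add_comm (c s₀ • v s₀)]
    congr 1
    · refine Finset.sum_congr rfl fun k hk => ?_
      have : k ≠ s₀ := (Finset.mem_erase.1 hk).1
      simp [hc, this]
    · simp [hc, s₀]
  have hcpos : ∀ k, 0 < c k := fun k => by
    by_cases h : k = s₀
    · simp only [hc, h, if_true]
      exact Finset.sum_pos (fun k hk => hr k (hAne k hk)) hne
    · simp [hc, h]
  have hxpos : 0 < ‖x‖ := norm_pos_iff.2 hxfut.ne_zero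
  have hsum : ∑ k, (‖x‖⁻¹ * c k) • v k = ‖x‖⁻¹ • x := by
    simp only [mul_smul, ← Finset.smul_sum, hxc]
  refine ⟨‖x‖⁻¹ • x, ?_, hxfut.normalize_mem_cap⟩
  rw [← hsum]
  refine hF.mem_sphericalRelint hv hS (fun k => mul_pos (inv_pos.2 hxpos) (hcpos k)) ?_
  rw [hsum]
  exact hxfut.normalize_mem_cap.2.2

end Lorentz

/-! ### Independence of small sets of generators. -/

section Independence

variable {V : Type*} [AddCommGroup V] [Module ℝ V] {d M : ℕ} {D : V [⋀^Fin (d + 1)]→ₗ[ℝ] ℝ}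
  {v : Fin (M + 1) → V}

lemma EndPositive.linearIndepOn (hD : EndPositive D v) (hM : d ≤ M) (T : Finset (Fin (M + 1)))
    (hT : T.card ≤ d) : LinearIndepOn ℝ v T := by
  -- Adjoining the index 0 makes the minor of the enlarged set one of those known to be positive;
  -- this is why only `d` elements are allowed.
  have h1 : (insert 0 T).card ≤ d + 1 := (Finset.card_insert_le _ _).trans (by omega)
  obtain ⟨U, hTU, -, hU⟩ := Finset.exists_subsuperset_card_eq (Finset.subset_univ (insert 0 T)) h1
    (by simpa using hM)
  have h0 : U.orderEmbOfFin hU 0 = 0 := by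
    obtain ⟨q, hq⟩ : (0 : Fin (M + 1)) ∈ Set.range (U.orderEmbOfFin hU) := by
      rw [Finset.range_orderEmbOfFin]
      exact hTU (Finset.mem_insert_self 0 T)
    exact le_antisymm (((U.orderEmbOfFin hU).monotone (Fin.zero_le q)).trans hq.le) (Fin.zero_le _)
  have hlin : LinearIndependent ℝ (v ∘ U.orderEmbOfFin hU) := by
    by_contra h
    have := hD _ (U.orderEmbOfFin hU).strictMono (Or.inl h0)
    rw [D.map_linearDependent _ h] at this
    exact this.false
  have hUlin : LinearIndepOn ℝ v U := by
    rw [LinearIndepOn, ← linearIndependent_equiv (U.orderIsoOfFin hU).toEquiv]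
    exact hlin
  exact hUlin.mono (Finset.coe_subset.2 ((Finset.subset_insert 0 T).trans hTU))

lemma EndPositive.ne_zero (hD : EndPositive D v) (hM : d ≤ M) (hd : 0 < d) (k : Fin (M + 1)) :
    v k ≠ 0 :=
  (hD.linearIndepOn hM {k} (by simp; omega)).ne_zero (by simp)

/-- Any three generators are independent as d ≥ 3, so a face with a two-dimensional span has exactly
two of them. -/
lemma EndPositive.exists_pair (hD : EndPositive D v) (hM : d ≤ M) (hd : 3 ≤ d)
    {S : Set (Fin (M + 1))} (hS : finrank ℝ (Submodule.span ℝ (v '' S)) = 2) :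
    ∃ i j, i < j ∧ S = {i, j} := by
  classical
  set T := S.toFinset with hT
  have hST : S = ↑T := by simp [hT]
  have hcard : ∀ U : Finset (Fin (M + 1)), U.card ≤ d →
      finrank ℝ (Submodule.span ℝ (v '' U)) = U.card := fun U hU => by
    have := hD.linearIndepOn hM U hU
    rw [Set.image_eq_range, finrank_span_eq_card this]
    simp
  have h2 : T.card = 2 := by
    by_contra hne
    by_cases hle : T.card ≤ d
    · rw [hST, hcard T hle] at hS
      exact hne hS
    · obtain ⟨U, hUT, hU⟩ := Finset.exists_subset_card_eq (show 3 ≤ T.card by omega)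
      have h3 := hcard U (by omega)
      have hfin : (v '' S).Finite := Set.toFinite _
      have : FiniteDimensional ℝ (Submodule.span ℝ (v '' S)) := FiniteDimensional.span_of_finite ℝ hfin
      have hle' := Submodule.finrank_mono
        (Submodule.span_mono (R := ℝ) (Set.image_mono (f := v) (hST ▸ Finset.coe_subset.2 hUT)))
      omega
  obtain ⟨i, j, hij, hTij⟩ := Finset.card_eq_two.1 h2
  rw [hST, hTij]
  rcases lt_or_gt_of_ne hij with h | h
  · exact ⟨i, j, h, by simp⟩
  · exact ⟨j, i, h, by simp [Set.pair_comm]⟩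

end Independence

/-! ### The scribed polytope: apices and sites. -/

section Construction

variable {D : ℕ}

/-- The vector with coordinates `a, b, s, u₁, …, u_D`. -/
def vec (a b s : ℝ) (u : Fin D → ℝ) : E (D + 2 + 1) :=
  WithLp.toLp 2 (Fin.cons a (Fin.cons b (Fin.cons s u)) : Fin (D + 2 + 1) → ℝ)

lemma vec_zero (a b s : ℝ) (u : Fin D → ℝ) : vec a b s u 0 = a := rfl

lemma vec_one (a b s : ℝ) (u : Fin D → ℝ) : vec a b s u 1 = b := rfl

lemma vec_two (a b s : ℝ) (u : Fin D → ℝ) : vec a b s u 2 = s := rfl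

lemma vec_succ (a b s : ℝ) (u : Fin D → ℝ) (i : Fin D) : vec a b s u i.succ.succ.succ = u i := rfl

lemma lorentz_vec (a b s a' b' s' : ℝ) (u u' : Fin D → ℝ) :
    lorentz (vec a b s u) (vec a' b' s' u') = -(a * a') + (b * b' + (s * s' + u ⬝ᵥ u')) := by
  rw [lorentz, Fin.sum_univ_succ, Fin.sum_univ_succ]
  rfl

lemma inner_vec (z : E (D + 2 + 1)) (a b s : ℝ) (u : Fin D → ℝ) :
    inner ℝ z (vec a b s u) =
      a * z 0 + (b * z 1 + (s * z 2 + u ⬝ᵥ fun i => z i.succ.succ.succ)) := by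
  simp only [PiLp.inner_apply, RCLike.inner_apply, conj_trivial, Fin.sum_univ_succ]
  rfl

/-- A horospherical parametrization: the vector with height `A` above `w`. -/
noncomputable def hor (A : ℝ) (w : Fin D → ℝ) : E (D + 2 + 1) := vec (A + 1 / 2) (A - 1 / 2) 0 w

/-- The two apices of the scribed cyclic polytope are `apex h` and `apex (-h)`. -/
def apex (D : ℕ) (h : ℝ) : E (D + 2 + 1) := vec 1 1 h 0

/-- The vertices of the scribed cyclic polytope that lie between the apices. -/
noncomputable def site (c : ℝ) (u : Fin D → ℝ) : E (D + 2 + 1) := hor (u ⬝ᵥ u / 2 - c) u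

lemma lorentz_hor_hor (A A' : ℝ) (w w' : Fin D → ℝ) :
    lorentz (hor A w) (hor A' w') = w ⬝ᵥ w' - (A + A') := by
  rw [hor, hor, lorentz_vec]
  ring

lemma lorentz_hor_apex (A h : ℝ) (w : Fin D → ℝ) : lorentz (hor A w) (apex D h) = -1 := by
  rw [hor, apex, lorentz_vec, dotProduct_zero]
  ring

lemma lorentz_apex_apex (h h' : ℝ) : lorentz (apex D h) (apex D h') = h * h' := by
  rw [apex, apex, lorentz_vec, dotProduct_zero]
  ring

lemma dotProduct_sub_self (u w : Fin D → ℝ) :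
    (u - w) ⬝ᵥ (u - w) = u ⬝ᵥ u + w ⬝ᵥ w - 2 * (u ⬝ᵥ w) := by
  simp only [sub_dotProduct, dotProduct_sub, dotProduct_comm w u]
  ring

lemma lorentz_site_site (c : ℝ) (u w : Fin D → ℝ) :
    lorentz (site c u) (site c w) = 2 * c - (u - w) ⬝ᵥ (u - w) / 2 := by
  rw [site, site, lorentz_hor_hor, dotProduct_sub_self]
  ring

lemma lorentz_site_apex (c h : ℝ) (u : Fin D → ℝ) : lorentz (site c u) (apex D h) = -1 :=
  lorentz_hor_apex _ _ _

lemma dotProduct_self_nonneg' (u : Fin D → ℝ) : 0 ≤ u ⬝ᵥ u :=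
  Finset.sum_nonneg fun i _ => mul_self_nonneg (u i)

/-- The Lorentzian square is 2c - 4c + 4c²h² = 0 when 2ch² = 1: the segment from apex to site
touches the light cone at this vector. -/
lemma isFuture_site_add_apex {c h : ℝ} (hc : 0 < c) (hch : 2 * c * (h * h) = 1) (u : Fin D → ℝ) :
    IsFuture (site c u + (2 * c) • apex D h) := by
  constructor
  · rw [lorentz_add_left, lorentz_add_right, lorentz_add_right, lorentz_smul_left,
      lorentz_smul_left, lorentz_smul_right, lorentz_smul_right, lorentz_comm (apex D h) (site c u),
      lorentz_site_apex, lorentz_site_site, lorentz_apex_apex, sub_self, dotProduct_zero, hch]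
    linarith
  · have h1 : (site c u + (2 * c) • apex D h) 0 = (u ⬝ᵥ u / 2 - c + 1 / 2) + 2 * c * 1 := rfl
    rw [h1]
    linarith [dotProduct_self_nonneg' u]

lemma isFuture_apex_zero : IsFuture (apex D 0) := by
  refine ⟨by rw [lorentz_apex_apex]; simp, ?_⟩
  have : apex D 0 0 = 1 := rfl
  rw [this]
  exact one_pos

/-- The segment between the apices touches the light cone at its midpoint, the null vector `apex D
0`. -/
lemma apex_add_apex_neg (h : ℝ) : apex D h + (1 : ℝ) • apex D (-h) = apex D 0 + apex D 0 := by
  ext i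
  rw [one_smul]
  simp only [PiLp.add_apply]
  refine Fin.cases ?_ (fun i => Fin.cases ?_ (fun i => Fin.cases ?_ (fun i => ?_) i) i) i
  · rfl
  · rfl
  · change h + -h = 0 + 0
    ring
  · rfl

/-- The point `(k, k², …, k^D)` of the moment curve. -/
def momentPoint (D k : ℕ) : Fin D → ℝ := fun i => (k : ℝ) ^ ((i : ℕ) + 1)

lemma momentPoint_injective (hD : 0 < D) : Function.Injective (momentPoint D) := by
  intro k l hkl
  have := congrFun hkl ⟨0, hD⟩
  simpa [momentPoint] using this

/-- The vertices of the scribed cyclic polytope. -/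
noncomputable def vertex (D M : ℕ) (c h : ℝ) (k : Fin (M + 1)) : E (D + 2 + 1) :=
  if (k : ℕ) = 0 then apex D h else if (k : ℕ) = M then apex D (-h) else site c (momentPoint D k)

/-- Adapted coordinates on `ℝ^(D+3)`. -/
noncomputable def adapted (D : ℕ) : E (D + 2 + 1) →ₗ[ℝ] (Fin (D + 2 + 1) → ℝ) where
  toFun z := Fin.snoc (Fin.snoc (Fin.cons (z 0 - z 1) fun i : Fin D => z i.succ.succ.succ :
    Fin (D + 1) → ℝ) ((z 0 + z 1) / 2) : Fin (D + 2) → ℝ) (z 2)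
  map_add' x y := by
    funext i
    refine Fin.lastCases ?_ (fun i => Fin.lastCases ?_ (fun i => Fin.cases ?_ (fun i => ?_) i) i) i
    · simp
    · simp; ring
    · simp; ring
    · simp only [Fin.snoc_castSucc, Fin.cons_succ, Pi.add_apply, PiLp.add_apply]
  map_smul' r x := by
    funext i
    refine Fin.lastCases ?_ (fun i => Fin.lastCases ?_ (fun i => Fin.cases ?_ (fun i => ?_) i) i) i
    · simp
    · simp; ring
    · simp; ring
    · simp only [Fin.snoc_castSucc, Fin.cons_succ, Pi.smul_apply, PiLp.smul_apply, RingHom.id_apply]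

lemma adapted_vec (a b s : ℝ) (u : Fin D → ℝ) : adapted D (vec a b s u) =
    Fin.snoc (Fin.snoc (Fin.cons (a - b) u : Fin (D + 1) → ℝ) ((a + b) / 2) : Fin (D + 2) → ℝ) s :=
  rfl

lemma adapted_apex (h : ℝ) : adapted D (apex D h) =
    Fin.snoc (Fin.snoc 0 1 : Fin (D + 2) → ℝ) h := by
  rw [apex, adapted_vec]
  congr 2
  · funext i
    refine Fin.cases ?_ (fun i => ?_) i <;> simp
  · norm_num

lemma adapted_site (c : ℝ) (k : ℕ) : adapted D (site c (momentPoint D k)) =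
    Fin.snoc (Fin.snoc (fun j : Fin (D + 1) => (k : ℝ) ^ (j : ℕ))
      ((heightPoly D c).eval (k : ℝ)) : Fin (D + 2) → ℝ) 0 := by
  rw [site, hor, adapted_vec]
  congr 2
  · funext i
    refine Fin.cases ?_ (fun i => ?_) i
    · norm_num
    · simp [momentPoint]
  · simp only [heightPoly, momentPoint, dotProduct, Polynomial.eval_sub, Polynomial.eval_mul,
      Polynomial.eval_C, Polynomial.eval_finsetSum, Polynomial.eval_pow, Polynomial.eval_X]
    have : ∀ x : ℝ, ∀ i : ℕ, x ^ (i + 1) * x ^ (i + 1) = x ^ (2 * (i + 1)) := fun x i => by ring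
    simp only [this]
    ring

lemma adapted_vertex (M : ℕ) (c h : ℝ) (k : Fin (M + 1)) : adapted D (vertex D M c h k) =
    Fin.snoc (frontRow D M c k) (lastCoord M h k) := by
  by_cases h0 : (k : ℕ) = 0
  · rw [vertex, if_pos h0, adapted_apex, frontRow, if_pos (Or.inl h0), lastCoord, if_pos h0]
  · by_cases hM : (k : ℕ) = M
    · rw [vertex, if_neg h0, if_pos hM, adapted_apex, frontRow, if_pos (Or.inr hM), lastCoord,
        if_neg h0, if_pos hM]
    · rw [vertex, if_neg h0, if_neg hM, adapted_site, frontRow, if_neg (by simp [h0, hM]),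
        lastCoord, if_neg h0, if_neg hM]

/-- The orientation for which the configuration of vertices is end-positive. -/
noncomputable def orientationForm (D : ℕ) : E (D + 2 + 1) [⋀^Fin (D + 2 + 1)]→ₗ[ℝ] ℝ :=
  -Matrix.detRowAlternating.compLinearMap (adapted D)

lemma endPositive_vertex (hD : Odd D) (M : ℕ) (c : ℝ) {h : ℝ} (hh : 0 < h) :
    EndPositive (orientationForm D) (vertex D M c h) := by
  intro κ hκ hend
  have hdet : orientationForm D (vertex D M c h ∘ κ) =
      -(Matrix.of fun i => adapted D (vertex D M c h (κ i))).det := rfl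
  rw [hdet]
  simp only [adapted_vertex]
  exact neg_pos.2 (det_rows_neg hD c hh hκ hend)

variable {M : ℕ} {c h : ℝ}

lemma vertex_zero : vertex D M c h 0 = apex D h := by simp [vertex]

lemma vertex_last (hM : M ≠ 0) : vertex D M c h (Fin.last M) = apex D (-h) := by simp [vertex, hM]

lemma vertex_site {k : Fin (M + 1)} (h0 : k ≠ 0) (hM : k ≠ Fin.last M) :
    vertex D M c h k = site c (momentPoint D k) := by
  have h0' : (k : ℕ) ≠ 0 := fun h => h0 (Fin.ext h)
  have hM' : (k : ℕ) ≠ M := fun h => hM (Fin.ext h)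
  rw [vertex, if_neg h0', if_neg hM']

lemma exists_inner_vertex_pos (D M : ℕ) (c h : ℝ) :
    ∃ a, ∀ k, 0 < inner ℝ a (vertex D M c h k) := by
  -- This vector pairs to 1 with the apices and to |u|²/2 + 1 with the site over u.
  refine ⟨vec (c + 3 / 2) (-c - 1 / 2) 0 0, fun k => ?_⟩
  have hapex : ∀ s, 0 < inner ℝ (vec (c + 3 / 2) (-c - 1 / 2) 0 0) (apex D s) := fun s => by
    rw [apex, inner_vec, vec_zero, vec_one, vec_two, zero_dotProduct]
    linarith
  by_cases h0 : k = 0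
  · rw [h0, vertex_zero]
    exact hapex h
  · by_cases hM : k = Fin.last M
    · rw [hM, vertex_last (by rintro rfl; exact h0 (Fin.ext (by omega)))]
      exact hapex (-h)
    · rw [vertex_site h0 hM, site, hor, inner_vec, vec_zero, vec_one, vec_two]
      simp only [vec_succ, Pi.zero_apply]
      have h1 := dotProduct_self_nonneg' (momentPoint D k)
      have h2 : (momentPoint D k ⬝ᵥ fun _ : Fin D => (0 : ℝ)) = 0 := dotProduct_zero _
      rw [h2]
      nlinarith

/-! ### Edges: Delaunay inequalities and causal normals. -/

/-- The paraboloid inequalities which say that a set of sites is a Delaunay face. -/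
def IsDelaunay (D M : ℕ) (S : Set (Fin (M + 1))) (η : Fin D → ℝ) (κ : ℝ) : Prop :=
  ∀ k, k ≠ 0 → k ≠ Fin.last M →
    0 ≤ momentPoint D k ⬝ᵥ momentPoint D k / 2 + η ⬝ᵥ momentPoint D k + κ ∧
      (momentPoint D k ⬝ᵥ momentPoint D k / 2 + η ⬝ᵥ momentPoint D k + κ = 0 ↔ k ∈ S)

/-- There are finitely many index sets, and the inequalities involve neither c nor h. The bound can
therefore be fixed before c is chosen, without circularity. -/
lemma exists_delaunay_bound (D M : ℕ) : ∃ C : ℝ, ∀ S, (∃ η κ, IsDelaunay D M S η κ) →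
    ∃ η κ, IsDelaunay D M S η κ ∧ η ⬝ᵥ η / 2 - κ ≤ C := by
  have h : ∀ S, ∃ r : ℝ, (∃ η κ, IsDelaunay D M S η κ) →
      ∃ η κ, IsDelaunay D M S η κ ∧ η ⬝ᵥ η / 2 - κ ≤ r := fun S => by
    by_cases hS : ∃ η κ, IsDelaunay D M S η κ
    · obtain ⟨η, κ, h⟩ := hS
      exact ⟨_, fun _ => ⟨η, κ, h, le_rfl⟩⟩
    · exact ⟨0, fun h => absurd h hS⟩
  choose r hr using h
  obtain ⟨C, hC⟩ := Finite.exists_le r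
  refine ⟨C, fun S hS => ?_⟩
  obtain ⟨η, κ, h, hle⟩ := hr S hS
  exact ⟨η, κ, h, hle.trans (hC S)⟩

/-- The values of `a` at the apices average to β = a₀ + a₁, which is negative because one of them
is. Dividing by β turns the condition at the sites into a paraboloid inequality, with c absorbed
into its constant. -/
lemma exists_isDelaunay_of_inner (hM : M ≠ 0) {a : E (D + 2 + 1)}
    (ha : ∀ k, inner ℝ a (vertex D M c h k) ≤ 0) (h0 : inner ℝ a (vertex D M c h 0) ≠ 0) :
    ∃ η κ, IsDelaunay D M {k | inner ℝ a (vertex D M c h k) = 0} η κ := by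
  have h1 := lt_of_le_of_ne (ha 0) h0
  have h2 := ha (Fin.last M)
  rw [vertex_zero, apex, inner_vec, zero_dotProduct] at h1
  rw [vertex_last hM, apex, inner_vec, zero_dotProduct] at h2
  have hβ : a 0 + a 1 < 0 := by linarith
  set β := a 0 + a 1 with hβdef
  have key : ∀ k, k ≠ 0 → k ≠ Fin.last M →
      momentPoint D k ⬝ᵥ momentPoint D k / 2 + (β⁻¹ • fun i : Fin D => a i.succ.succ.succ) ⬝ᵥ
        momentPoint D k + ((a 0 - a 1) / (2 * β) - c) =
      β⁻¹ * inner ℝ a (vertex D M c h k) := fun k hk0 hkM => by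
    have hcomm := dotProduct_comm (fun i : Fin D => a i.succ.succ.succ) (momentPoint D k)
    rw [vertex_site hk0 hkM, site, hor, inner_vec, smul_dotProduct, smul_eq_mul, hcomm]
    have hne : a 0 + a 1 ≠ 0 := hβ.ne
    rw [hβdef]
    field_simp
    ring
  refine ⟨β⁻¹ • fun i : Fin D => a i.succ.succ.succ, (a 0 - a 1) / (2 * β) - c,
    fun k hk0 hkM => ?_⟩
  rw [key k hk0 hkM]
  refine ⟨mul_nonneg_of_nonpos_of_nonpos (inv_nonpos.2 hβ.le) (ha k), ?_⟩
  rw [mul_eq_zero, or_iff_right (inv_ne_zero hβ.ne)]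
  rfl

lemma forall_vertex (hM : M ≠ 0) {p : Fin (M + 1) → E (D + 2 + 1) → Prop} (h0 : p 0 (apex D h))
    (h1 : p (Fin.last M) (apex D (-h)))
    (h2 : ∀ k : Fin (M + 1), k ≠ 0 → k ≠ Fin.last M → p k (site c (momentPoint D k))) :
    ∀ k, p k (vertex D M c h k) := fun k => by
  by_cases hk0 : k = 0
  · rw [hk0, vertex_zero]; exact h0
  · by_cases hkM : k = Fin.last M
    · rw [hkM, vertex_last hM]; exact h1
    · rw [vertex_site hk0 hkM]; exact h2 k hk0 hkM

lemma lorentz_site_add_apex (s : ℝ) (u : Fin D → ℝ) :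
    (∀ w, lorentz (site c u + (2 * c) • apex D h) (site c w) = -((u - w) ⬝ᵥ (u - w) / 2)) ∧
      lorentz (site c u + (2 * c) • apex D h) (apex D s) = -1 + 2 * c * (h * s) := by
  constructor
  · intro w
    rw [lorentz_add_left, lorentz_smul_left, lorentz_comm (apex D h), lorentz_site_apex,
      lorentz_site_site]
    ring
  · rw [lorentz_add_left, lorentz_smul_left, lorentz_site_apex, lorentz_apex_apex]

lemma dotProduct_momentPoint_sub_eq_zero_iff (hD : 0 < D) (k l : ℕ) :
    (momentPoint D k - momentPoint D l) ⬝ᵥ (momentPoint D k - momentPoint D l) = 0 ↔ k = l := by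
  rw [dotProduct_self_eq_zero, sub_eq_zero, (momentPoint_injective hD).eq_iff]

/-- For every edge there is a causal vector orthogonal to exactly its two vertices. -/
lemma exists_isFuture_edge (hD : 0 < D) (hM : M ≠ 0) (hc : 0 < c) (hch : 2 * c * (h * h) = 1)
    (hbound : ∀ S, (∃ η κ, IsDelaunay D M S η κ) →
      ∃ η κ, IsDelaunay D M S η κ ∧ η ⬝ᵥ η / 2 - κ ≤ c)
    {a : E (D + 2 + 1)} (ha : ∀ k, inner ℝ a (vertex D M c h k) ≤ 0) {i j : Fin (M + 1)}
    (hij : i < j) (hS : {k | inner ℝ a (vertex D M c h k) = 0} = {i, j}) :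
    ∃ T, IsFuture T ∧ ∀ k, lorentz T (vertex D M c h k) ≤ 0 ∧
      (lorentz T (vertex D M c h k) = 0 ↔ k ∈ ({i, j} : Set (Fin (M + 1)))) := by
  have hi : i ≠ Fin.last M := (hij.trans_le (Fin.le_last j)).ne
  have hj : j ≠ 0 := (lt_of_le_of_lt (Fin.zero_le i) hij).ne'
  have h0M : (0 : Fin (M + 1)) ≠ Fin.last M := by
    rw [Ne, Fin.ext_iff]
    simpa using hM.symm
  have hnn := fun k l : ℕ => dotProduct_self_nonneg' (momentPoint D k - momentPoint D l)
  have hzero := dotProduct_momentPoint_sub_eq_zero_iff hD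
  have hall := fun T => forall_vertex (D := D) (c := c) (h := h) hM (p := fun k z =>
    lorentz T z ≤ 0 ∧ (lorentz T z = 0 ↔ k ∈ ({i, j} : Set (Fin (M + 1)))))
  by_cases hi0 : i = 0
  · subst hi0
    by_cases hjM : j = Fin.last M
    · subst hjM
      -- The null midpoint is orthogonal to both apices and has product -1 with every site.
      refine ⟨apex D 0, isFuture_apex_zero, hall _ ?_ ?_ fun k hk0 hkM => ?_⟩
      · simp [lorentz_apex_apex]
      · simp [lorentz_apex_apex]
      · rw [lorentz_comm, lorentz_site_apex]
        simp [hk0, hkM]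
    -- The point of tangency is the normal: its products are 0 with its own apex, -2 with the other
    -- one, and -|u - w|²/2 with the site over w.
    · refine ⟨_, isFuture_site_add_apex hc hch (momentPoint D j),
        hall _ ?_ ?_ fun k hk0 hkM => ?_⟩
      · rw [(lorentz_site_add_apex h _).2, hch]
        simp
      · rw [(lorentz_site_add_apex (-h) _).2]
        have : -1 + 2 * c * (h * -h) = -2 := by linarith
        rw [this]
        simp [h0M.symm, Ne.symm hjM]
      · rw [(lorentz_site_add_apex h _).1]
        refine ⟨by linarith [hnn j k], ?_⟩
        rw [neg_eq_zero, div_eq_zero_iff, or_iff_left (by norm_num), hzero,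
          ← Fin.ext_iff, Set.mem_insert_iff, Set.mem_singleton_iff, or_iff_right hk0, eq_comm]
  · by_cases hjM : j = Fin.last M
    · subst hjM
      refine ⟨_, isFuture_site_add_apex (h := -h) hc (by rw [← hch]; ring) (momentPoint D i),
        hall _ ?_ ?_ fun k hk0 hkM => ?_⟩
      · rw [(lorentz_site_add_apex h _).2]
        have : -1 + 2 * c * (-h * h) = -2 := by linarith
        rw [this]
        simp [h0M, Ne.symm hi0]
      · rw [(lorentz_site_add_apex (-h) _).2]
        have : -1 + 2 * c * (-h * -h) = 0 := by linarith
        rw [this]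
        simp
      · rw [(lorentz_site_add_apex h _).1]
        refine ⟨by linarith [hnn i k], ?_⟩
        rw [neg_eq_zero, div_eq_zero_iff, or_iff_left (by norm_num), hzero,
          ← Fin.ext_iff, Set.mem_insert_iff, Set.mem_singleton_iff, or_iff_left hkM, eq_comm]
    · have h0 : inner ℝ a (vertex D M c h 0) ≠ 0 := fun h => by
        have : (0 : Fin (M + 1)) ∈ ({i, j} : Set (Fin (M + 1))) := hS.subset h
        simp [Ne.symm hi0, Ne.symm hj] at this
      have hdel := exists_isDelaunay_of_inner hM ha h0
      rw [hS] at hdel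
      obtain ⟨η, κ, hdel, hle⟩ := hbound _ hdel
      have hηη := dotProduct_self_nonneg' η
      -- The product with a site is minus the Delaunay expression, and with an apex it is -1. The
      -- vector is causal exactly when η·η/2 - κ ≤ c.
      refine ⟨hor (κ + c) (-η), ⟨?_, ?_⟩, hall _ ?_ ?_ fun k hk0 hkM => ?_⟩
      · rw [lorentz_hor_hor, neg_dotProduct_neg]
        linarith
      · have : (hor (κ + c) (-η)) 0 = κ + c + 1 / 2 := rfl
        rw [this]
        linarith
      · rw [lorentz_hor_apex]
        simp [Ne.symm hi0, Ne.symm hj]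
      · rw [lorentz_hor_apex]
        simp [Ne.symm hi, Ne.symm hjM]
      · have hval : lorentz (hor (κ + c) (-η)) (site c (momentPoint D k)) =
            -(momentPoint D k ⬝ᵥ momentPoint D k / 2 + η ⬝ᵥ momentPoint D k + κ) := by
          rw [site, lorentz_hor_hor, neg_dotProduct]
          ring
        obtain ⟨h1, h2⟩ := hdel k hk0 hkM
        rw [hval, neg_eq_zero, h2]
        exact ⟨by linarith, Iff.rfl⟩

lemma vertex_add_apex_isFuture (hM : M ≠ 0) (hc : 0 < c) (hch : 2 * c * (h * h) = 1)
    {k₀ : Fin (M + 1)} (hk₀ : k₀ = 0 ∨ k₀ = Fin.last M) (k : Fin (M + 1)) (hk : k ≠ k₀) :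
    ∃ r : ℝ, 0 < r ∧ IsFuture (vertex D M c h k + r • vertex D M c h k₀) := by
  have hsum : IsFuture (apex D 0 + apex D 0) := isFuture_apex_zero.add isFuture_apex_zero
  rcases hk₀ with rfl | rfl
  · rw [vertex_zero]
    by_cases hkM : k = Fin.last M
    · subst hkM
      refine ⟨1, one_pos, ?_⟩
      rw [vertex_last hM]
      have := apex_add_apex_neg (D := D) (-h)
      rw [neg_neg] at this
      rwa [this]
    · rw [vertex_site hk hkM]
      exact ⟨2 * c, by linarith, isFuture_site_add_apex hc hch _⟩
  · rw [vertex_last hM]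
    by_cases hk0 : k = 0
    · subst hk0
      refine ⟨1, one_pos, ?_⟩
      rwa [vertex_zero, apex_add_apex_neg]
    · rw [vertex_site hk0 hk]
      exact ⟨2 * c, by linarith, isFuture_site_add_apex hc (by rw [← hch]; ring) _⟩

/-! ### Facets contain an apex; scribedness of the polytope. -/

/-- The coordinate that vanishes on all sites. -/
def coordTwo (D : ℕ) : E (D + 2 + 1) →ₗ[ℝ] ℝ where
  toFun z := z 2
  map_add' _ _ := rfl
  map_smul' _ _ := rfl

lemma finrank_ker_coordTwo (D : ℕ) : finrank ℝ (LinearMap.ker (coordTwo D)) = D + 2 := by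
  have h := LinearMap.finrank_range_add_finrank_ker (coordTwo D)
  have hsurj : LinearMap.range (coordTwo D) = ⊤ :=
    LinearMap.range_eq_top.2 fun r => ⟨vec 0 0 r 0, rfl⟩
  rw [hsurj, finrank_top, finrank_self, finrank_euclideanSpace_fin] at h
  omega

/-- A facet spanned by sites alone would span the hyperplane of vanishing third coordinate. That
contains the midpoint of the apices, so `a`, non-positive at both apices, would vanish at both. -/
lemma exists_apex_mem_facet (hM : M ≠ 0) {a : E (D + 2 + 1)}
    (ha : ∀ k, inner ℝ a (vertex D M c h k) ≤ 0)
    (hS : finrank ℝ (Submodule.span ℝ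
      (vertex D M c h '' {k | inner ℝ a (vertex D M c h k) = 0})) = D + 2) :
    ∃ k₀, (k₀ = 0 ∨ k₀ = Fin.last M) ∧ inner ℝ a (vertex D M c h k₀) = 0 := by
  by_contra! hcon
  have h0 := hcon 0 (Or.inl rfl)
  have h1 := hcon _ (Or.inr rfl)
  have hle : Submodule.span ℝ (vertex D M c h '' {k | inner ℝ a (vertex D M c h k) = 0}) ≤
      LinearMap.ker (coordTwo D) := by
    refine Submodule.span_le.2 ?_
    rintro _ ⟨k, hk, rfl⟩
    have hk0 : k ≠ 0 := by rintro rfl; exact h0 hk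
    have hkM : k ≠ Fin.last M := by rintro rfl; exact h1 hk
    rw [vertex_site hk0 hkM]
    rfl
  have heq := Submodule.eq_of_le_of_finrank_eq hle (by rw [hS, finrank_ker_coordTwo])
  have hmem : apex D 0 ∈ LinearMap.ker (coordTwo D) := rfl
  rw [← heq] at hmem
  have hker : Submodule.span ℝ (vertex D M c h '' {k | inner ℝ a (vertex D M c h k) = 0}) ≤
      LinearMap.ker (innerₛₗ ℝ a) := by
    refine Submodule.span_le.2 ?_
    rintro _ ⟨k, hk, rfl⟩
    exact hk
  have hz : inner ℝ a (apex D 0) = 0 := hker hmem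
  have hadd := congrArg (inner ℝ a) (apex_add_apex_neg (D := D) h)
  rw [one_smul, inner_add_right, inner_add_right, hz] at hadd
  have h2 := ha 0
  have h3 := ha (Fin.last M)
  rw [vertex_zero] at h0 h2
  rw [vertex_last hM] at h3
  exact h0 (by linarith)

/-- The spherical polytope spanned by the vertices is `(1, d - 1)`-scribed. -/
lemma isScribed_vertex (hD : Odd D) (hDM : D + 2 ≤ M) (hc : 0 < c) (hh : 0 < h)
    (hch : 2 * c * (h * h) = 1)
    (hbound : ∀ S, (∃ η κ, IsDelaunay D M S η κ) →
      ∃ η κ, IsDelaunay D M S η κ ∧ η ⬝ᵥ η / 2 - κ ≤ c) :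
    IsScribed 1 (D + 2 - 1) (coneSection (vertex D M c h)) := by
  have hpos := endPositive_vertex hD M c hh
  have hv := hpos.ne_zero hDM (by omega)
  have hM : M ≠ 0 := by omega
  have hD0 := hD.pos
  constructor
  · rintro F ⟨⟨a, ha⟩, hrank⟩
    have ha' := (forall_coneSection_inner_nonpos_iff hv).1 ha.1
    rw [ha.span_eq hv] at hrank
    obtain ⟨i, j, hij, hS⟩ := hpos.exists_pair hDM (by omega) hrank
    obtain ⟨T, hT, hTv⟩ := exists_isFuture_edge hD0 hM hc hch hbound ha' hij hS
    refine ha.stronglyAvoids hv ?_ hT fun k => ⟨(hTv k).1, ?_⟩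
    · by_contra! hall
      have huniv : (Set.univ : Set (Fin (M + 1))) = {i, j} := by
        rw [← hS]
        exact (Set.eq_univ_of_forall hall).symm
      have hcard := congrArg Set.ncard huniv
      rw [Set.ncard_univ, Nat.card_eq_fintype_card, Fintype.card_fin, Set.ncard_pair hij.ne] at hcard
      omega
    · rw [(hTv k).2, ← hS]
      rfl
  · rintro F ⟨⟨a, ha⟩, hrank⟩
    have ha' := (forall_coneSection_inner_nonpos_iff hv).1 ha.1
    rw [ha.span_eq hv] at hrank
    obtain ⟨k₀, hk₀, hk₀F⟩ := exists_apex_mem_facet hM ha' (by omega)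
    obtain ⟨k₁, hk₁, hne⟩ : ∃ k₁, inner ℝ a (vertex D M c h k₁) = 0 ∧ k₁ ≠ k₀ := by
      by_contra! hall
      have hsub : vertex D M c h '' {k | inner ℝ a (vertex D M c h k) = 0} ⊆
          {vertex D M c h k₀} := by
        rintro _ ⟨k, hk, rfl⟩
        rw [hall k hk]
        rfl
      have := Submodule.finrank_mono (Submodule.span_mono (R := ℝ) hsub)
      rw [hrank, finrank_span_singleton (hv k₀)] at this
      omega
    exact ha.stronglyCuts hv hk₀F hk₁ hne (vertex_add_apex_isFuture hM hc hch hk₀)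

lemma isSphericalDPolytope_vertex (hD : Odd D) (hDM : D + 2 ≤ M) (c : ℝ) (hh : 0 < h) :
    IsSphericalDPolytope (D + 2) (coneSection (vertex D M c h)) := by
  have hpos := endPositive_vertex hD M c hh
  have hv := hpos.ne_zero hDM (by omega)
  obtain ⟨a, ha⟩ := exists_inner_vertex_pos D M c h
  refine ⟨⟨Set.range (vertex D M c h), Set.finite_range _,
    fun x hx hx0 => neg_notMem_hull_of_inner_pos ha hx hx0, rfl⟩, ?_⟩
  rw [span_coneSection hv]
  exact hpos.span_eq_top hDM finrank_euclideanSpace_fin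

end Construction

end Scribability

/-! ### Choice of the constants and conclusion. -/

theorem mainTheorem11 (d n : ℕ) (hd : Odd d) (hd3 : 3 ≤ d)
    (L : Type*) [PartialOrder L] (hL : Scribability.IsCyclicType d n L) :
    Scribability.IsScribable d 1 (d - 1) L := by
  open Scribability in
  obtain ⟨D, rfl⟩ : ∃ D, d = D + 2 := ⟨d - 2, by omega⟩
  have hdn := hL.1
  obtain ⟨M, rfl⟩ : ∃ M, n = M + 1 := ⟨n - 1, by omega⟩
  have hD : Odd D := by
    rw [Nat.odd_add] at hd
    exact hd.2 even_two
  have hDM : D + 2 ≤ M := by omega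
  obtain ⟨C, hC⟩ := exists_delaunay_bound D M
  -- With c = 2r² and h = 1/(2r) the tangency condition 2ch² = 1 holds without square roots, and r ≥
  -- 1 gives C ≤ r ≤ c.
  set r := max 1 C with hr
  have hr1 : 1 ≤ r := le_max_left _ _
  have hrC : C ≤ 2 * r ^ 2 := (le_max_right 1 C).trans (by rw [← hr]; nlinarith)
  have hh : 0 < 1 / (2 * r) := by positivity
  have hch : 2 * (2 * r ^ 2) * (1 / (2 * r) * (1 / (2 * r))) = 1 := by
    field_simp
  have hpos := endPositive_vertex hD M (2 * r ^ 2) hh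
  refine ⟨_, isSphericalDPolytope_vertex hD hDM (2 * r ^ 2) hh,
    isScribed_vertex hD hDM (by positivity) hh hch fun S hS => ?_, ?_⟩
  · obtain ⟨η, κ, h1, h2⟩ := hC S hS
    exact ⟨η, κ, h1, h2.trans hrC⟩
  · obtain ⟨e⟩ := nonempty_sphericalFaces_orderIso (hpos.ne_zero hDM (by omega))
    obtain ⟨e'⟩ := hL.nonempty_orderIso hd finrank_euclideanSpace_fin hpos
    exact ⟨e.trans e'⟩
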